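/- Let $T$ be a finite set of targets, $D$ a finite nonempty set of depots and $C_1,\dots,C_m$ a partition of $T$ into nonempty clusters. Let $G=(V,E)$ be the undirected graph with $V=T\cup D$ in which any two distinct vertices are adjacent, except that two depots are never adjacent. For $S\subseteq V$ let $\gamma(S)$ be the set of edges with both ends in $S$ and $\delta(S)$ the set of edges with exactly one end in $S$; for disjoint $A,B\subseteq V$ let $(A:B)$ be the set of edges with one end in $A$ and the other in $B$; write $x(F)=\sum_{e\in F}x_e$ for $F\subseteq E$, and $x(A:B)$ for $x((A:B))$. Let $W$ be the set of targets whose cluster has exactly one element. Let $P\subset\mathbb R^{E}\times\mathbb R^{T}$ be the convex hull of all $(x,y)$ satisfying - $x(\delta(\{i\}))=2y_i$ for all $i\in T$; - $\sum_{i\in C_h}y_i\ge 1$ for all $h$; - $x(\delta(S))\ge 2y_i$ for all $S\subseteq T$, $i\in S$; - $x(D':\{j\})+3x_{jk}+x(\{k\}:D\setminus D')\le 2(y_j+y_k)$ for all distinct $j,k\in T$, $D'\subseteq D$; - $x(D':\{j\})+2x(\gamma(S\cup\{j,k\}))+x(\{k\}:D\setminus D')\le \sum_{v\in S}2y_v+2(y_j+y_k)-y_i$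 for all distinct $j,k\in T$, $\emptyset\ne S\subseteq T\setminus\{j,k\}$, $i\in S$, $D'\subseteq D$; - $x_e\in\{0,1\}$ for $e\in\gamma(T)$, $x_e\in\{0,1,2\}$ for $e\in(D:T)$, and $y_i\in\{0,1\}$ for $i\in T$. An inequality defines a facet of $P$ if it is valid for $P$ and the set of points of $P$ satisfying it with equality is nonempty and has dimension $\dim P-1$. Then: 1. If $|T|\ge 4$, then $x_e\ge 0$ defines a facet of $P$ for every $e\in E$. 2. Unless $|D|=1$ and $|T|=2$, for every $e\in E$ the inequality $x_e\le 1$ defines a facet of $P$ if and only if $e\in\gamma(W)$ and $|T|\ge 3$. 3. Unless $|D|+|T|=3$, the inequality $x_e\le 2$ does not define a facet of $P$ for any $e\in(D:T)$. 4. $y_i\ge 0$ does not define a facet of $P$ for any $i\in T$. 5. For every $i\in T$, $y_i\le 1$ defines a facet of $P$ if and only if $i\notin W$. 6. $\sum_{i\in C_h}y_i\ge 1$ does not define a facet of $P$ for any $h$. -/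

import Mathlib

namespace GMDTSP

/-- The graph on targets `T` and depots `D`: any two distinct vertices are adjacent, except that
there are no edges between depots. -/
def graph (T D : Type*) : SimpleGraph (T ⊕ D) where
  Adj u v := u ≠ v ∧ (u.isLeft ∨ v.isLeft)
  symm := ⟨fun _ _ h => ⟨h.1.symm, h.2.symm⟩⟩
  loopless := ⟨fun _ h => h.1 rfl⟩

/-- The edge set `E`. -/
abbrev Edge (T D : Type*) : Type _ := (graph T D).edgeSet

noncomputable instance (T D : Type*) [Fintype T] [Fintype D] : Fintype (Edge T D) :=
  Fintype.ofFinite _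

section Notions

variable {T D : Type*}

/-- The edge joining two distinct targets `j` and `k`. -/
def targetEdge (j k : T) (h : j ≠ k) : Edge T D :=
  ⟨s(Sum.inl j, Sum.inl k), by simp [graph, h]⟩

/-- `γ(S)`: the edges with both ends in `S`. -/
def γ (S : Set (T ⊕ D)) : Set (Edge T D) :=
  {e | ∃ u v, e.1 = s(u, v) ∧ u ∈ S ∧ v ∈ S}

/-- `δ(S)`: the edges with one end in `S` and the other outside `S`. -/
def δ (S : Set (T ⊕ D)) : Set (Edge T D) :=
  {e | ∃ u v, e.1 = s(u, v) ∧ u ∈ S ∧ v ∉ S}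

/-- `(A : B)`: the edges with one end in `A` and the other in `B`. -/
def between (A B : Set (T ⊕ D)) : Set (Edge T D) :=
  {e | ∃ u v, e.1 = s(u, v) ∧ u ∈ A ∧ v ∈ B}

/-- A set of targets, as a set of vertices. -/
def targets (S : Set T) : Set (T ⊕ D) := Sum.inl '' S

/-- A set of depots, as a set of vertices. -/
def depots (S : Set D) : Set (T ⊕ D) := Sum.inr '' S

open Classical in
/-- `x(A) = ∑_{e ∈ A} x_e`. -/
noncomputable def total [Fintype T] [Fintype D] (x : Edge T D → ℝ) (A : Set (Edge T D)) : ℝ :=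
  ∑ e with e ∈ A, x e

/-- The targets that are alone in their cluster. -/
def W [Fintype T] [DecidableEq T] (C : Finpartition (Finset.univ : Finset T)) : Set T :=
  {v | (C.part v).card = 1}

/-- The feasible solutions `(x, y)` of the integer program for the generalized multiple depot
traveling salesmen problem with targets `T`, depots `D` and clusters the parts of `C`. -/
structure IsFeasible [Fintype T] [DecidableEq T] [Fintype D]
    (C : Finpartition (Finset.univ : Finset T))
    (z : (Edge T D → ℝ) × (T → ℝ)) : Prop where
  /-- degree constraints -/
  degree : ∀ i : T, total z.1 (δ (targets {i})) = 2 * z.2 i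
  /-- every cluster is visited -/
  assignment : ∀ c ∈ C.parts, 1 ≤ ∑ i ∈ c, z.2 i
  /-- sub-tour elimination constraints -/
  subtour : ∀ S : Finset T, ∀ i ∈ S, 2 * z.2 i ≤ total z.1 (δ (targets (S : Set T)))
  /-- path elimination constraints for two targets -/
  path₂ : ∀ (j k : T) (hjk : j ≠ k) (D' : Set D),
    total z.1 (between (depots D') (targets {j})) + 3 * z.1 (targetEdge j k hjk)
      + total z.1 (between (targets {k}) (depots D'ᶜ)) ≤ 2 * (z.2 j + z.2 k)
  /-- path elimination constraints for three or more targets -/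
  path : ∀ (j k : T) (S : Finset T) (i : T) (D' : Set D), j ≠ k → j ∉ S → k ∉ S → i ∈ S →
    total z.1 (between (depots D') (targets {j}))
      + 2 * total z.1 (γ (targets ((S : Set T) ∪ {j, k})))
      + total z.1 (between (targets {k}) (depots D'ᶜ))
      ≤ ∑ v ∈ S, 2 * z.2 v + 2 * (z.2 j + z.2 k) - z.2 i
  /-- integrality on edges between targets -/
  int_target : ∀ e ∈ γ (targets Set.univ), z.1 e = 0 ∨ z.1 e = 1
  /-- integrality on edges between a depot and a target -/
  int_depot : ∀ e ∈ between (depots Set.univ) (targets Set.univ),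
    z.1 e = 0 ∨ z.1 e = 1 ∨ z.1 e = 2
  /-- integrality on targets -/
  int_y : ∀ i : T, z.2 i = 0 ∨ z.2 i = 1

/-- The polytope `P`: the convex hull of the feasible solutions. -/
def polytope [Fintype T] [DecidableEq T] [Fintype D]
    (C : Finpartition (Finset.univ : Finset T)) : Set ((Edge T D → ℝ) × (T → ℝ)) :=
  convexHull ℝ {z | IsFeasible C z}

end Notions

/-- The inequality `f z ≤ g z` (with `f`, `g` affine functions) defines a facet of `P`: it is valid
for `P`, and the face `{z ∈ P | f z = g z}` is nonempty of dimension `dim P - 1`. The dimension of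
a set is that of its affine hull, i.e. the rank of the span of its difference vectors. -/
def DefinesFacet {M : Type*} [AddCommGroup M] [Module ℝ M] (P : Set M) (f g : M → ℝ) : Prop :=
  (∀ z ∈ P, f z ≤ g z) ∧ {z ∈ P | f z = g z}.Nonempty ∧
    Module.finrank ℝ (vectorSpan ℝ {z ∈ P | f z = g z}) + 1 = Module.finrank ℝ (vectorSpan ℝ P)

end GMDTSP

/-! Let `X` be the set of feasible points. A face of the convex hull of `X` is the convex hull of
the points of `X` on it, so only spans of differences of feasible points matter
(`definesFacet_convexHull_iff`).

Fix a depot `d₀`. Differences of feasible points satisfy the homogeneous degree equations and have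
`y_i = 0` for `i ∈ W`. Every such vector combines the directions `shiftVec d₀ e`, which reroute
through `e` at the expense of edges from `d₀`, and the cycles `cycleVec d₀ i []` with `i ∉ W`, which
add or drop the target `i` (`eq_sum_shiftVec_add`). Conversely, these generators lie in the span
(`shiftVec_mem`, `cycleVec_mem`).

No dimension is ever computed. An inequality defines a facet once the span of its face and one
further vector contain all generators (`definesFacet_of_span`). It fails to do so when a second,
independent equation holds on the face (`not_definesFacet_of_linearMap`), or when the face is empty
or everything, or the inequality is invalid.

Feasible points are made as sums of target-disjoint cycles, each through a single depot. The
homogeneous constraints survive addition, so they need checking on one cycle only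
(`isTourSum_cycleVec`), where they rest on `x(γ(S)) ≤ y(S) - y_i` for `i ∈ S`. The delicate facets
are `x_e ≥ 0` for a depot edge of the only depot and `x_e ≤ 1` for an edge inside `W`; there each
generator is exhibited as a difference of explicit tours, up to a multiple of one vector. -/

namespace GMDTSP

set_option linter.unusedSectionVars false

/-! ### Facets of convex hulls -/

section Convex

variable {M : Type*} [AddCommGroup M] [Module ℝ M]

/-- The points with `L z ≤ c` that lie in the smaller hull whenever `L z = c` form a convex set
containing `X`. -/
theorem convexHull_inter_face (X : Set M) (L : M →ₗ[ℝ] ℝ) (c : ℝ) (hX : ∀ z ∈ X, L z ≤ c) :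
    {z ∈ convexHull ℝ X | L z = c} = convexHull ℝ {z ∈ X | L z = c} := by
  apply Set.Subset.antisymm
  · have hQ : convexHull ℝ X ⊆ {z | L z ≤ c ∧ (L z = c → z ∈ convexHull ℝ {z ∈ X | L z = c})} := by
      apply convexHull_min
      · exact fun z hz => ⟨hX z hz, fun h => subset_convexHull _ _ ⟨hz, h⟩⟩
      · rintro z ⟨hz, hz'⟩ w ⟨hw, hw'⟩ a b ha hb hab
        simp only [Set.mem_ofPred_eq, map_add, map_smul, smul_eq_mul]
        have h₁ := mul_le_mul_of_nonneg_left hz ha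
        have h₂ := mul_le_mul_of_nonneg_left hw hb
        have h₃ : a * c + b * c = c := by rw [← add_mul, hab, one_mul]
        refine ⟨by linarith, fun h => ?_⟩
        -- A point of weight zero need not lie on the hyperplane, so the two extreme weights are
        -- split off; with both weights positive, equality for the combination forces it at both
        -- points.
        rcases ha.eq_or_lt with rfl | ha
        · obtain rfl : b = 1 := by linarith
          simpa using hw' (by linarith)
        rcases hb.eq_or_lt with rfl | hb
        · obtain rfl : a = 1 := by linarith
          simpa using hz' (by linarith)
        refine convex_convexHull ℝ _ (hz' ?_) (hw' ?_) ha.le hb.le hab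
        · exact le_antisymm hz (le_of_mul_le_mul_left (by linarith) ha)
        · exact le_antisymm hw (le_of_mul_le_mul_left (by linarith) hb)
    exact fun z hz => (hQ hz.1).2 hz.2
  · apply convexHull_min
    · exact fun z hz => ⟨subset_convexHull _ _ hz.1, hz.2⟩
    · exact (convex_convexHull ℝ X).inter (convex_hyperplane L.isLinear c)

theorem vectorSpan_convexHull (X : Set M) : vectorSpan ℝ (convexHull ℝ X) = vectorSpan ℝ X := by
  rw [← direction_affineSpan, affineSpan_convexHull, direction_affineSpan]

theorem definesFacet_convexHull_iff (X : Set M) (f g : M → ℝ) (L : M →ₗ[ℝ] ℝ) (c : ℝ)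
    (h : ∀ z, g z - f z = c - L z) :
    DefinesFacet (convexHull ℝ X) f g ↔ (∀ z ∈ X, L z ≤ c) ∧ {z ∈ X | L z = c}.Nonempty ∧
      Module.finrank ℝ (vectorSpan ℝ {z ∈ X | L z = c}) + 1
        = Module.finrank ℝ (vectorSpan ℝ X) := by
  have hle : ∀ z, f z ≤ g z ↔ L z ≤ c := fun z => by
    have := h z
    constructor <;> intro <;> linarith
  have heq : ∀ z, f z = g z ↔ L z = c := fun z => by
    have := h z
    constructor <;> intro <;> linarith
  have hface : {z ∈ convexHull ℝ X | f z = g z} = {z ∈ convexHull ℝ X | L z = c} := by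
    simp only [heq]
  rw [DefinesFacet, hface]
  simp only [hle]
  have hval : (∀ z ∈ convexHull ℝ X, L z ≤ c) ↔ ∀ z ∈ X, L z ≤ c :=
    ⟨fun H z hz => H z (subset_convexHull _ _ hz), fun H z hz =>
      convexHull_min (t := {z | L z ≤ c}) H (convex_halfSpace_le L.isLinear c) hz⟩
  rw [hval]
  refine and_congr_right fun H => ?_
  rw [convexHull_inter_face X L c H, vectorSpan_convexHull, vectorSpan_convexHull,
    convexHull_nonempty_iff]

theorem linearMap_eq_zero_of_mem_vectorSpan {X : Set M} (L : M →ₗ[ℝ] ℝ) (c : ℝ)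
    (h : ∀ z ∈ X, L z = c) {v : M} (hv : v ∈ vectorSpan ℝ X) : L v = 0 := by
  have : vectorSpan ℝ X ≤ LinearMap.ker L := by
    rw [vectorSpan, Submodule.span_le]
    rintro _ ⟨a, ha, b, hb, rfl⟩
    simp [h a ha, h b hb]
  exact this hv

/-- The spanning hypothesis bounds the codimension of the face by one; the point `z₂` off the
hyperplane shows that it is not zero. -/
theorem definesFacet_of_span [FiniteDimensional ℝ M] (X : Set M) (f g : M → ℝ)
    (L : M →ₗ[ℝ] ℝ) (c : ℝ)
    (h : ∀ z, g z - f z = c - L z) (hX : ∀ z ∈ X, L z ≤ c) {z₁ z₂ : M}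
    (h₁ : z₁ ∈ X) (h₁' : L z₁ = c) (h₂ : z₂ ∈ X) (h₂' : L z₂ ≠ c) (v : M)
    (hv : vectorSpan ℝ X ≤ vectorSpan ℝ {z ∈ X | L z = c} ⊔ Submodule.span ℝ {v}) :
    DefinesFacet (convexHull ℝ X) f g := by
  rw [definesFacet_convexHull_iff X f g L c h]
  refine ⟨hX, ⟨z₁, h₁, h₁'⟩, le_antisymm ?_ ?_⟩
  · apply Submodule.finrank_lt_finrank_of_lt
    refine lt_of_le_of_ne (vectorSpan_mono ℝ fun z hz => hz.1) fun heq => ?_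
    have hm : z₂ - z₁ ∈ vectorSpan ℝ {z ∈ X | L z = c} := heq ▸ vsub_mem_vectorSpan ℝ h₂ h₁
    have := linearMap_eq_zero_of_mem_vectorSpan L c (fun z hz => hz.2) hm
    rw [map_sub, h₁'] at this
    exact h₂' (by linarith)
  · refine (Submodule.finrank_mono hv).trans
      ((Submodule.finrank_add_le_finrank_add_finrank _ _).trans ?_)
    gcongr
    simpa using finrank_span_le_card (R := ℝ) {v}

theorem not_definesFacet_of_const (X : Set M) (f g : M → ℝ) (L : M →ₗ[ℝ] ℝ) (c : ℝ)
    (h : ∀ z, g z - f z = c - L z) (hX : ∀ z ∈ X, L z = c) :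
    ¬ DefinesFacet (convexHull ℝ X) f g := by
  rw [definesFacet_convexHull_iff X f g L c h]
  rintro ⟨-, -, hr⟩
  rw [show {z ∈ X | L z = c} = X from Set.sep_eq_self_iff_mem_true.2 hX] at hr
  omega

/-- The span of the face lies in `ker L'`. It is smaller than the part of the span of `X` in `ker
L'` because of `v`, and that part is smaller than the whole because of `v'`. The codimension is
therefore at least two. -/
theorem not_definesFacet_of_linearMap [FiniteDimensional ℝ M] (X : Set M) (f g : M → ℝ)
    (L : M →ₗ[ℝ] ℝ) (c : ℝ)
    (h : ∀ z, g z - f z = c - L z) (L' : M →ₗ[ℝ] ℝ) (c' : ℝ)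
    (hL' : ∀ z ∈ X, L z = c → L' z = c') {v v' : M} (hv : v ∈ vectorSpan ℝ X)
    (hv' : v' ∈ vectorSpan ℝ X) (h₁ : L v ≠ 0) (h₂ : L' v = 0) (h₃ : L' v' ≠ 0) :
    ¬ DefinesFacet (convexHull ℝ X) f g := by
  rw [definesFacet_convexHull_iff X f g L c h]
  rintro ⟨-, -, hr⟩
  have hlt₁ : vectorSpan ℝ {z ∈ X | L z = c} < vectorSpan ℝ X ⊓ LinearMap.ker L' := by
    refine lt_of_le_of_ne (le_inf (vectorSpan_mono ℝ fun z hz => hz.1) fun w hw => ?_) fun heq => ?_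
    · exact linearMap_eq_zero_of_mem_vectorSpan L' c' (fun z hz => hL' z hz.1 hz.2) hw
    · have hm : v ∈ vectorSpan ℝ {z ∈ X | L z = c} := heq ▸ ⟨hv, h₂⟩
      exact h₁ (linearMap_eq_zero_of_mem_vectorSpan L c (fun z hz => hz.2) hm)
  have hlt₂ : vectorSpan ℝ X ⊓ LinearMap.ker L' < vectorSpan ℝ X := by
    refine lt_of_le_of_ne inf_le_left fun heq => ?_
    rw [← heq] at hv'
    exact h₃ hv'.2
  have := Submodule.finrank_lt_finrank_of_lt hlt₁
  have := Submodule.finrank_lt_finrank_of_lt hlt₂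
  omega

end Convex

/-! ### Tours -/

section Tours

variable {T D : Type*}

/-- The space of the vectors `(x, y)`. -/
abbrev Vec (T D : Type*) : Type _ := (Edge T D → ℝ) × (T → ℝ)

/-- The edge joining the depot `d` and the target `j`. -/
def depotEdge (d : D) (j : T) : Edge T D :=
  ⟨s(Sum.inr d, Sum.inl j), by simp [graph]⟩

theorem edge_cases (e : Edge T D) :
    (∃ j k, ∃ h : j ≠ k, e = targetEdge j k h) ∨ ∃ d j, e = depotEdge d j := by
  obtain ⟨e, he⟩ := e
  induction e with
  | _ u v =>
    rcases u with j | d <;> rcases v with k | d'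
    · exact Or.inl ⟨j, k, by simpa [graph] using he, rfl⟩
    · exact Or.inr ⟨d', j, Subtype.ext Sym2.eq_swap⟩
    · exact Or.inr ⟨d, k, rfl⟩
    · simp [graph] at he

theorem targetEdge_comm {j k : T} (h : j ≠ k) :
    (targetEdge j k h : Edge T D) = targetEdge k j h.symm := Subtype.ext Sym2.eq_swap

@[simp] theorem targetEdge_inj {j k l m : T} (h : j ≠ k) (h' : l ≠ m) :
    (targetEdge j k h : Edge T D) = targetEdge l m h' ↔ j = l ∧ k = m ∨ j = m ∧ k = l := by
  simp [targetEdge, Subtype.ext_iff]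

@[simp] theorem depotEdge_inj {d d' : D} {j k : T} :
    depotEdge d j = depotEdge d' k ↔ d = d' ∧ j = k := by
  simp [depotEdge, Subtype.ext_iff]

@[simp] theorem targetEdge_ne_depotEdge {j k l : T} (h : j ≠ k) (d : D) :
    targetEdge j k h ≠ depotEdge d l := by
  simp [targetEdge, depotEdge, Subtype.ext_iff]

@[simp] theorem depotEdge_ne_targetEdge {j k l : T} (h : j ≠ k) (d : D) :
    depotEdge d l ≠ targetEdge j k h := (targetEdge_ne_depotEdge h d).symm

theorem targetEdge_mem_γ {j k : T} (h : j ≠ k) (S : Set T) :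
    (targetEdge j k h : Edge T D) ∈ γ (targets S) ↔ j ∈ S ∧ k ∈ S := by
  constructor
  · rintro ⟨_, _, h, ⟨a, ha, rfl⟩, ⟨b, hb, rfl⟩⟩
    simp only [targetEdge, Sym2.eq_iff, Sum.inl.injEq] at h
    rcases h with ⟨rfl, rfl⟩ | ⟨rfl, rfl⟩
    · exact ⟨ha, hb⟩
    · exact ⟨hb, ha⟩
  · rintro ⟨hj, hk⟩
    exact ⟨_, _, rfl, ⟨j, hj, rfl⟩, ⟨k, hk, rfl⟩⟩

theorem depotEdge_notMem_γ (d : D) (j : T) (S : Set T) :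
    depotEdge d j ∉ γ (targets S) := by
  rintro ⟨_, _, h, ⟨a, ha, rfl⟩, ⟨b, hb, rfl⟩⟩
  simp [depotEdge] at h

theorem targetEdge_mem_δ {j k : T} (h : j ≠ k) (S : Set T) :
    (targetEdge j k h : Edge T D) ∈ δ (targets S) ↔ (j ∈ S ∧ k ∉ S) ∨ (k ∈ S ∧ j ∉ S) := by
  constructor
  · rintro ⟨_, b, h, ⟨a, ha, rfl⟩, hb⟩
    simp only [targetEdge, Sym2.eq_iff, Sum.inl.injEq] at h
    rcases h with ⟨rfl, rfl⟩ | ⟨rfl, rfl⟩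
    · exact Or.inl ⟨ha, by simpa [targets] using hb⟩
    · exact Or.inr ⟨ha, by simpa [targets] using hb⟩
  · rintro (⟨hj, hk⟩ | ⟨hj, hk⟩)
    · exact ⟨_, _, rfl, ⟨j, hj, rfl⟩, by simpa [targets] using hk⟩
    · exact ⟨_, _, Sym2.eq_swap, ⟨k, hj, rfl⟩, by simpa [targets] using hk⟩

theorem depotEdge_mem_δ (d : D) (j : T) (S : Set T) :
    depotEdge d j ∈ δ (targets S) ↔ j ∈ S := by
  constructor
  · rintro ⟨_, b, h, ⟨a, ha, rfl⟩, hb⟩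
    simp only [depotEdge, Sym2.eq_iff, Sum.inl.injEq, reduceCtorEq, false_and, false_or] at h
    rwa [h.2]
  · exact fun hj => ⟨_, _, Sym2.eq_swap, ⟨j, hj, rfl⟩, by simp [targets]⟩

theorem between_comm (A B : Set (T ⊕ D)) : between A B = between B A := by
  ext e
  constructor <;> rintro ⟨u, v, h, hu, hv⟩ <;> exact ⟨v, u, h.trans Sym2.eq_swap, hv, hu⟩

theorem targetEdge_notMem_between {j k : T} (h : j ≠ k) (D' : Set D) (S : Set T) :
    targetEdge j k h ∉ between (depots D') (targets S) := by
  rintro ⟨_, b, h, ⟨a, ha, rfl⟩, hb⟩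
  simp [targetEdge] at h

theorem depotEdge_mem_between (d : D) (j : T) (D' : Set D) (S : Set T) :
    depotEdge d j ∈ between (depots D') (targets S) ↔ d ∈ D' ∧ j ∈ S := by
  constructor
  · rintro ⟨_, _, h, ⟨a, ha, rfl⟩, ⟨b, hb, rfl⟩⟩
    simp only [depotEdge, Sym2.eq_iff, Sum.inr.injEq, Sum.inl.injEq, reduceCtorEq, false_and,
      or_false] at h
    exact ⟨h.1 ▸ ha, h.2 ▸ hb⟩
  · rintro ⟨hd, hj⟩
    exact ⟨_, _, rfl, ⟨d, hd, rfl⟩, ⟨j, hj, rfl⟩⟩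

open Classical in
/-- The unit vector of the edge `uv`. -/
noncomputable def edgeVec (u v : T ⊕ D) : Vec T D := (fun e => if e.1 = s(u, v) then 1 else 0, 0)

theorem edgeVec_comm (u v : T ⊕ D) : edgeVec u v = edgeVec v u := by
  rw [edgeVec, edgeVec, show s(u, v) = s(v, u) from Sym2.eq_swap]

@[simp] theorem edgeVec_snd (u v : T ⊕ D) : (edgeVec u v).2 = 0 := rfl

open Classical in
theorem edgeVec_fst_apply {u v : T ⊕ D} (e : Edge T D) (h : e.1 = s(u, v)) (f : Edge T D) :
    (edgeVec u v).1 f = if f = e then 1 else 0 := by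
  simp [edgeVec, Subtype.ext_iff, h]

open Classical in
@[simp] theorem edgeVec_inl_inl {j k : T} (h : j ≠ k) (f : Edge T D) :
    (edgeVec (Sum.inl j) (Sum.inl k)).1 f = if f = targetEdge j k h then 1 else 0 :=
  edgeVec_fst_apply _ rfl f

open Classical in
@[simp] theorem edgeVec_inr_inl (d : D) (j : T) (f : Edge T D) :
    (edgeVec (Sum.inr d) (Sum.inl j)).1 f = if f = depotEdge d j then 1 else 0 :=
  edgeVec_fst_apply _ rfl f

/-- The unit vector of the target `j`. -/
noncomputable def targetVec [DecidableEq T] (j : T) : Vec T D := (0, Pi.single j 1)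

@[simp] theorem targetVec_fst [DecidableEq T] (j : T) : (targetVec j : Vec T D).1 = 0 := rfl

@[simp] theorem targetVec_snd [DecidableEq T] (j i : T) :
    (targetVec j : Vec T D).2 i = if i = j then 1 else 0 := by
  simp [targetVec, Pi.single_apply]

variable [Fintype T] [Fintype D]

theorem total_add (x x' : Edge T D → ℝ) (A : Set (Edge T D)) :
    total (x + x') A = total x A + total x' A := by
  simp [total, Finset.sum_add_distrib]

theorem total_smul (c : ℝ) (x : Edge T D → ℝ) (A : Set (Edge T D)) :
    total (c • x) A = c * total x A := by
  simp [total, Finset.mul_sum]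

@[simp] theorem total_zero (A : Set (Edge T D)) : total (0 : Edge T D → ℝ) A = 0 := by
  simp [total]

open Classical in
theorem total_edgeVec {u v : T ⊕ D} (e : Edge T D) (h : e.1 = s(u, v)) (A : Set (Edge T D)) :
    total (edgeVec u v).1 A = if e ∈ A then 1 else 0 := by
  simp [total, edgeVec_fst_apply e h, Finset.sum_ite_eq']

variable [DecidableEq T]

theorem total_γ_target {j k : T} (h : j ≠ k) (S : Finset T) :
    total (edgeVec (Sum.inl j) (Sum.inl k) : Vec T D).1 (γ (targets (S : Set T)))
      = if j ∈ S ∧ k ∈ S then 1 else 0 := by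
  simp [total_edgeVec (targetEdge j k h) rfl, targetEdge_mem_γ]

theorem total_γ_depot (d : D) (j : T) (S : Finset T) :
    total (edgeVec (Sum.inr d) (Sum.inl j)).1 (γ (targets (S : Set T))) = 0 := by
  simp [total_edgeVec (depotEdge d j) rfl, depotEdge_notMem_γ]

theorem total_δ_target {j k : T} (h : j ≠ k) (S : Finset T) :
    total (edgeVec (Sum.inl j) (Sum.inl k) : Vec T D).1 (δ (targets (S : Set T)))
      = (if j ∈ S then 1 else 0) + (if k ∈ S then 1 else 0)
        - 2 * total (edgeVec (Sum.inl j) (Sum.inl k) : Vec T D).1 (γ (targets (S : Set T))) := by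
  rw [total_γ_target h, total_edgeVec (targetEdge j k h) rfl]
  by_cases hj : j ∈ S <;> by_cases hk : k ∈ S <;> simp [targetEdge_mem_δ, hj, hk]; norm_num

theorem total_δ_depot (d : D) (j : T) (S : Finset T) :
    total (edgeVec (Sum.inr d) (Sum.inl j)).1 (δ (targets (S : Set T)))
      = if j ∈ S then 1 else 0 := by
  simp [total_edgeVec (depotEdge d j) rfl, depotEdge_mem_δ]

theorem total_between_target {j k : T} (h : j ≠ k) (D' : Set D) (l : T) :
    total (edgeVec (Sum.inl j) (Sum.inl k) : Vec T D).1 (between (depots D') (targets {l})) = 0 := by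
  simp [total_edgeVec (targetEdge j k h) rfl, targetEdge_notMem_between]

open Classical in
theorem total_between_depot (d : D) (j : T) (D' : Set D) (l : T) :
    total (edgeVec (Sum.inr d) (Sum.inl j)).1 (between (depots D') (targets {l}))
      = if d ∈ D' ∧ j = l then 1 else 0 := by
  simp [total_edgeVec (depotEdge d j) rfl, depotEdge_mem_between]

/-- The sum of the unit vectors of the vertices and edges of the path through the targets `a :: l`. -/
noncomputable def pathVec : T → List T → Vec T D
  | a, [] => targetVec a
  | a, b :: l => targetVec a + edgeVec (Sum.inl a) (Sum.inl b) + pathVec b l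

/-- The last vertex of the path `a :: l`. -/
def pathEnd : T → List T → T
  | a, [] => a
  | _, b :: l => pathEnd b l

theorem pathEnd_mem (a : T) (l : List T) : pathEnd a l ∈ a :: l := by
  induction l generalizing a with
  | nil => simp [pathEnd]
  | cons b l ih => exact List.mem_cons_of_mem _ (ih b)

/-- The solution that consists of the cycle through the depot `d` and the targets `a :: l`. -/
noncomputable def cycleVec (d : D) (a : T) (l : List T) : Vec T D :=
  pathVec a l + edgeVec (Sum.inr d) (Sum.inl a)
    + edgeVec (Sum.inr d) (Sum.inl (pathEnd a l))

theorem pathVec_snd (a : T) (l : List T) (h : (a :: l).Nodup) (i : T) :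
    (pathVec a l : Vec T D).2 i = if i ∈ a :: l then 1 else 0 := by
  induction l generalizing a with
  | nil => simp [pathVec]
  | cons b l ih =>
    rw [List.nodup_cons] at h
    rw [pathVec, Prod.snd_add, Pi.add_apply, ih b h.2]
    by_cases hi : i = a
    · subst hi; simp [h.1]
    · simp [hi]

/-- A path meets `S` in a forest, which has fewer edges than vertices as soon as it has a vertex.
The induction keeps `i` free, because an edge from `a` into `S` has to be paid for by the instance
at `b`. -/
theorem total_γ_pathVec_add_le (S : Finset T) (i : T) (hi : i ∈ S) (a : T) (l : List T)
    (h : (a :: l).Nodup) :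
    total (pathVec a l : Vec T D).1 (γ (targets (S : Set T))) + (pathVec a l : Vec T D).2 i
      ≤ ∑ v ∈ S, (pathVec a l : Vec T D).2 v := by
  induction l generalizing a i with
  | nil => simp [pathVec]; split_ifs <;> simp_all
  | cons b l ih =>
    have hab : a ≠ b := by rintro rfl; simp at h
    rw [List.nodup_cons] at h
    have hs : ∑ v ∈ S, (pathVec a (b :: l) : Vec T D).2 v
        = (if a ∈ S then 1 else 0) + ∑ v ∈ S, (pathVec b l : Vec T D).2 v := by
      simp [pathVec, Finset.sum_add_distrib]
    rw [hs]
    simp only [pathVec, Prod.fst_add, total_add, total_γ_target hab, Prod.snd_add, Pi.add_apply,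
      targetVec_fst, total_zero, targetVec_snd, edgeVec_snd, Pi.zero_apply]
    have hia := ih i hi b h.2
    by_cases hb : b ∈ S
    · have hbb := ih b hb b h.2
      rw [pathVec_snd b l h.2] at hbb hia ⊢
      by_cases hi' : i = a
      · subst hi'
        simp [h.1, hi, hb] at hbb hia ⊢
        linarith
      · by_cases ha : a ∈ S <;> simp [hi', ha, hb] at hbb hia ⊢ <;> linarith
    · rw [pathVec_snd b l h.2] at hia ⊢
      by_cases hi' : i = a
      · subst hi'
        simp [h.1, hi, hb] at hia ⊢
        linarith
      · by_cases ha : a ∈ S <;> simp [hi', ha, hb] at hia ⊢ <;> linarith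

/-- Degree count over `S`: vertices on the path have degree two, except that each end loses one. For
a path with one vertex both losses fall on it. -/
theorem total_δ_pathVec (S : Finset T) (a z : T) (l : List T) (h : (a :: l).Nodup)
    (hz : pathEnd a l = z) :
    total (pathVec a l : Vec T D).1 (δ (targets (S : Set T)))
      = 2 * ∑ v ∈ S, (pathVec a l : Vec T D).2 v
        - 2 * total (pathVec a l : Vec T D).1 (γ (targets (S : Set T)))
        - (if a ∈ S then 1 else 0) - (if z ∈ S then 1 else 0) := by
  induction l generalizing a with
  | nil => obtain rfl : a = z := hz; simp [pathVec]; split_ifs <;> norm_num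
  | cons b l ih =>
    have hab : a ≠ b := by rintro rfl; simp at h
    rw [List.nodup_cons] at h
    have hs : ∑ v ∈ S, (pathVec a (b :: l) : Vec T D).2 v
        = (if a ∈ S then 1 else 0) + ∑ v ∈ S, (pathVec b l : Vec T D).2 v := by
      simp [pathVec, Finset.sum_add_distrib]
    rw [hs]
    simp only [pathVec, Prod.fst_add, total_add, total_δ_target hab, targetVec_fst, total_zero,
      ih b h.2 hz]
    ring

theorem total_between_pathVec (a : T) (l : List T) (h : (a :: l).Nodup) (D' : Set D) (k : T) :
    total (pathVec a l : Vec T D).1 (between (depots D') (targets {k})) = 0 := by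
  induction l generalizing a with
  | nil => simp [pathVec]
  | cons b l ih =>
    have hab : a ≠ b := by rintro rfl; simp at h
    rw [List.nodup_cons] at h
    simp [pathVec, total_add, total_between_target hab, ih b h.2]

theorem total_γ_cycleVec (d : D) (a : T) (l : List T) (S : Finset T) :
    total (cycleVec d a l).1 (γ (targets (S : Set T)))
      = total (pathVec a l : Vec T D).1 (γ (targets (S : Set T))) := by
  simp [cycleVec, total_add, total_γ_depot]

/-- The two depot edges make up for the two ends of the path. -/
theorem total_δ_cycleVec (d : D) (a : T) (l : List T) (h : (a :: l).Nodup) (S : Finset T) :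
    total (cycleVec d a l).1 (δ (targets (S : Set T)))
      = 2 * ∑ v ∈ S, (cycleVec d a l).2 v
        - 2 * total (cycleVec d a l).1 (γ (targets (S : Set T))) := by
  rw [total_γ_cycleVec]
  simp [cycleVec, total_add, total_δ_depot, total_δ_pathVec S a _ l h rfl]
  ring

theorem cycleVec_snd (d : D) (a : T) (l : List T) (h : (a :: l).Nodup) (i : T) :
    (cycleVec d a l).2 i = if i ∈ a :: l then 1 else 0 := by
  rw [← pathVec_snd (D := D) a l h]
  simp [cycleVec]

theorem total_γ_cycleVec_add_le (d : D) (a : T) (l : List T) (h : (a :: l).Nodup)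
    (S : Finset T) (i : T) (hi : i ∈ S) :
    total (cycleVec d a l).1 (γ (targets (S : Set T))) + (cycleVec d a l).2 i
      ≤ ∑ v ∈ S, (cycleVec d a l).2 v := by
  rw [total_γ_cycleVec]
  simpa [cycleVec] using total_γ_pathVec_add_le (D := D) S i hi a l h

open Classical in
theorem total_between_cycleVec (d : D) (a : T) (l : List T) (h : (a :: l).Nodup)
    (D' : Set D) (k : T) :
    total (cycleVec d a l).1 (between (depots D') (targets {k}))
      = (if d ∈ D' ∧ a = k then 1 else 0)
        + if d ∈ D' ∧ pathEnd a l = k then 1 else 0 := by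
  simp [cycleVec, total_add, total_between_depot, total_between_pathVec a l h]

theorem edgeVec_fst_natural (u v : T ⊕ D) (e : Edge T D) : ∃ n : ℕ, (edgeVec u v).1 e = n := by
  classical
  exact ⟨if e.1 = s(u, v) then 1 else 0, by simp [edgeVec]⟩

theorem pathVec_fst_natural (a : T) (l : List T) (e : Edge T D) :
    ∃ n : ℕ, (pathVec a l : Vec T D).1 e = n := by
  induction l generalizing a with
  | nil => exact ⟨0, by simp [pathVec]⟩
  | cons b l ih =>
    obtain ⟨n, hn⟩ := ih b
    obtain ⟨m, hm⟩ := edgeVec_fst_natural (Sum.inl a) (Sum.inl b) e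
    exact ⟨m + n, by simp [pathVec, hn, hm, -edgeVec_inl_inl]⟩

theorem cycleVec_fst_natural (d : D) (a : T) (l : List T) (e : Edge T D) :
    ∃ n : ℕ, (cycleVec d a l).1 e = n := by
  obtain ⟨n, hn⟩ := pathVec_fst_natural a l e
  obtain ⟨m, hm⟩ := edgeVec_fst_natural (Sum.inr d) (Sum.inl a) e
  obtain ⟨k, hk⟩ := edgeVec_fst_natural (Sum.inr d) (Sum.inl (pathEnd a l)) e
  exact ⟨n + m + k, by simp [cycleVec, hn, hm, hk, -edgeVec_inr_inl]⟩

end Tours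

/-! ### Sums of cycles are feasible -/

section Feasible

variable {T D : Type*} [Fintype T] [DecidableEq T] [Fintype D]

/-- The homogeneous constraints of the integer program, with natural edge values. -/
structure IsTourSum (z : Vec T D) : Prop where
  natural : ∀ e, ∃ n : ℕ, z.1 e = n
  degree : ∀ i : T, total z.1 (δ (targets {i})) = 2 * z.2 i
  subtour : ∀ S : Finset T, ∀ i ∈ S, 2 * z.2 i ≤ total z.1 (δ (targets (S : Set T)))
  path₂ : ∀ (j k : T) (hjk : j ≠ k) (D' : Set D),
    total z.1 (between (depots D') (targets {j})) + 3 * z.1 (targetEdge j k hjk)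
      + total z.1 (between (targets {k}) (depots D'ᶜ)) ≤ 2 * (z.2 j + z.2 k)
  path : ∀ (j k : T) (S : Finset T) (i : T) (D' : Set D), j ≠ k → j ∉ S → k ∉ S → i ∈ S →
    total z.1 (between (depots D') (targets {j}))
      + 2 * total z.1 (γ (targets ((S : Set T) ∪ {j, k})))
      + total z.1 (between (targets {k}) (depots D'ᶜ))
      ≤ ∑ v ∈ S, 2 * z.2 v + 2 * (z.2 j + z.2 k) - z.2 i

theorem IsTourSum.zero : IsTourSum (0 : Vec T D) where
  natural e := ⟨0, by simp⟩
  degree i := by simp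
  subtour S i hi := by simp
  path₂ j k hjk D' := by simp
  path j k S i D' _ _ _ _ := by simp

/-- All constraints kept in `IsTourSum` are homogeneous, and edge values are only asked to be
natural numbers, so that sums stay inside. The upper bounds on the edges are recovered in
`IsTourSum.isFeasible`. -/
theorem IsTourSum.add {z z' : Vec T D} (h : IsTourSum z) (h' : IsTourSum z') :
    IsTourSum (z + z') where
  natural e := by
    obtain ⟨n, hn⟩ := h.natural e
    obtain ⟨m, hm⟩ := h'.natural e
    exact ⟨n + m, by simp [hn, hm]⟩
  degree i := by
    simp only [Prod.fst_add, Prod.snd_add, total_add, Pi.add_apply, h.degree i, h'.degree i]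
    ring
  subtour S i hi := by
    have h₁ := h.subtour S i hi
    have h₂ := h'.subtour S i hi
    simp only [Prod.fst_add, Prod.snd_add, total_add, Pi.add_apply]
    linarith
  path₂ j k hjk D' := by
    have h₁ := h.path₂ j k hjk D'
    have h₂ := h'.path₂ j k hjk D'
    simp only [Prod.fst_add, Prod.snd_add, total_add, Pi.add_apply]
    linarith
  path j k S i D' hjk hj hk hi := by
    have h₁ := h.path j k S i D' hjk hj hk hi
    have h₂ := h'.path j k S i D' hjk hj hk hi
    simp only [Prod.fst_add, Prod.snd_add, total_add, Pi.add_apply, mul_add,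
      Finset.sum_add_distrib] at *
    linarith

theorem IsTourSum.sum {ι : Type*} (s : Finset ι) (f : ι → Vec T D) (h : ∀ i ∈ s, IsTourSum (f i)) :
    IsTourSum (∑ i ∈ s, f i) :=
  Finset.sum_induction f IsTourSum (fun _ _ => IsTourSum.add) IsTourSum.zero h

theorem total_nonneg {x : Edge T D → ℝ} (hx : ∀ e, 0 ≤ x e) (A : Set (Edge T D)) :
    0 ≤ total x A :=
  Finset.sum_nonneg fun e _ => hx e

theorem le_total_of_mem {x : Edge T D → ℝ} (hx : ∀ e, 0 ≤ x e) {A : Set (Edge T D)} {e : Edge T D}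
    (he : e ∈ A) : x e ≤ total x A := by
  classical
  exact Finset.single_le_sum (fun e _ => hx e) (by simpa using he)

theorem cycleVec_nonneg (d : D) (a : T) (l : List T) (e : Edge T D) : 0 ≤ (cycleVec d a l).1 e := by
  obtain ⟨n, hn⟩ := cycleVec_fst_natural d a l e
  simp [hn]

theorem cycleVec_snd_nonneg (d : D) (a : T) (l : List T) (h : (a :: l).Nodup) (i : T) :
    0 ≤ (cycleVec d a l).2 i := by
  rw [cycleVec_snd d a l h]; split_ifs <;> norm_num

theorem cycleVec_fst_targetEdge_le (d : D) (a : T) (l : List T) (h : (a :: l).Nodup) {j k : T}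
    (hjk : j ≠ k) : (cycleVec d a l).1 (targetEdge j k hjk) ≤ (cycleVec d a l).2 j ∧
      (cycleVec d a l).1 (targetEdge j k hjk) ≤ (cycleVec d a l).2 k := by
  have h₀ : (cycleVec d a l).1 (targetEdge j k hjk)
      ≤ total (cycleVec d a l).1 (γ (targets (({j, k} : Finset T) : Set T))) :=
    le_total_of_mem (cycleVec_nonneg d a l) ((targetEdge_mem_γ hjk _).2 (by simp))
  have h₁ := total_γ_cycleVec_add_le d a l h {j, k} j (by simp)
  have h₂ := total_γ_cycleVec_add_le d a l h {j, k} k (by simp)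
  rw [Finset.sum_pair hjk] at h₁ h₂
  constructor <;> linarith

/-- Only one of the two depot terms of the path elimination constraints is nonzero on a cycle, and
a cycle with two targets or more has depot edges of value at most one. -/
theorem total_between_cycleVec_le (d : D) (a : T) (l : List T) (h : (a :: l).Nodup)
    (D' : Set D) (j k : T) :
    ∃ q, (q = j ∨ q = k) ∧ total (cycleVec d a l).1 (between (depots D') (targets {j}))
      + total (cycleVec d a l).1 (between (targets {k}) (depots D'ᶜ))
        ≤ (if l = [] then 2 else 1) * (cycleVec d a l).2 q := by
  classical
  -- For a single target both indicators can be one, as the depot edge is doubled. Otherwise the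
  -- first and last targets differ, so at most one of them is `q`.
  have key : ∀ z, pathEnd a l = z → ∀ q, ((if a = q then 1 else 0) + if z = q then 1 else 0 : ℝ)
      ≤ (if l = [] then 2 else 1) * (cycleVec d a l).2 q := by
    intro z hz q
    rw [cycleVec_snd d a l h]
    rcases l with _ | ⟨b, l⟩
    · obtain rfl : a = z := hz
      by_cases h₁ : a = q
      · simp [h₁]; norm_num
      · simp [h₁, Ne.symm h₁]
    · replace hz : pathEnd b l = z := hz
      have hb := hz ▸ pathEnd_mem b l
      have hne : a ≠ z := by
        rintro rfl
        exact (List.nodup_cons.1 h).1 hb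
      by_cases h₁ : a = q
      · subst h₁
        simp [hne.symm]
      · by_cases h₂ : z = q
        · subst h₂
          simp [h₁, List.mem_cons_of_mem _ hb]
        · simp only [h₁, h₂, if_false, reduceCtorEq]
          split_ifs <;> norm_num
  rw [between_comm (targets {k}), total_between_cycleVec d a l h, total_between_cycleVec d a l h]
  by_cases hd : d ∈ D'
  · exact ⟨j, Or.inl rfl, by simpa [hd] using key _ rfl j⟩
  · exact ⟨k, Or.inr rfl, by simpa [hd] using key _ rfl k⟩

/-- Degree and sub-tour constraints come from `x(δ(S)) = 2y(S) - 2x(γ(S))` and the forest bound. The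
path constraints hold because a cycle uses one depot, which lies on one side of the split into `D'`
and its complement. -/
theorem isTourSum_cycleVec (d : D) (a : T) (l : List T) (h : (a :: l).Nodup) :
    IsTourSum (cycleVec d a l) where
  natural := cycleVec_fst_natural d a l
  degree i := by
    have h₁ := total_δ_cycleVec d a l h {i}
    have h₂ := total_γ_cycleVec_add_le d a l h {i} i (by simp)
    have h₃ := total_nonneg (cycleVec_nonneg d a l) (γ (targets (({i} : Finset T) : Set T)))
    simp only [Finset.sum_singleton, Finset.coe_singleton] at h₁ h₂ h₃
    linarith
  subtour S i hi := by
    have h₁ := total_δ_cycleVec d a l h S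
    have h₂ := total_γ_cycleVec_add_le d a l h S i hi
    linarith
  path₂ j k hjk D' := by
    obtain ⟨q, hq, ht⟩ := total_between_cycleVec_le d a l h D' j k
    obtain ⟨h₁, h₂⟩ := cycleVec_fst_targetEdge_le d a l h hjk
    have hj := cycleVec_snd_nonneg d a l h j
    have hk := cycleVec_snd_nonneg d a l h k
    split_ifs at ht with hl
    · subst hl
      have : (cycleVec d a []).2 j = 0 ∨ (cycleVec d a []).2 k = 0 := by
        rw [cycleVec_snd d a _ h, cycleVec_snd d a _ h]
        by_cases hja : j = a
        · subst hja; simp [hjk.symm]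
        · simp [hja]
      rcases hq with rfl | rfl <;> rcases this with h₀ | h₀ <;> linarith
    · rcases hq with rfl | rfl <;> linarith
  path j k S i D' hjk hj hk hi := by
    obtain ⟨q, hq, ht⟩ := total_between_cycleVec_le d a l h D' j k
    have hU : (S : Set T) ∪ {j, k} = ((insert j (insert k S) : Finset T) : Set T) := by
      ext v; simp
    have hs : ∑ v ∈ insert j (insert k S), (cycleVec d a l).2 v
        = (cycleVec d a l).2 j + ((cycleVec d a l).2 k + ∑ v ∈ S, (cycleVec d a l).2 v) := by
      rw [Finset.sum_insert (by simp [hjk, hj]), Finset.sum_insert hk]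
    have hyj := cycleVec_snd_nonneg d a l h j
    have hyk := cycleVec_snd_nonneg d a l h k
    rw [hU, ← Finset.mul_sum]
    split_ifs at ht with hl
    · subst hl
      have hγ : total (cycleVec d a []).1
          (γ (targets ((insert j (insert k S) : Finset T) : Set T))) = 0 := by
        rw [total_γ_cycleVec]; simp [pathVec]
      have hi₁ : (cycleVec d a []).2 i ≤ ∑ v ∈ S, (cycleVec d a []).2 v :=
        Finset.single_le_sum (fun v _ => cycleVec_snd_nonneg d a [] h v) hi
      have hi₀ := cycleVec_snd_nonneg d a [] h i
      rw [hγ]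
      rcases hq with rfl | rfl <;> linarith
    · have h₁ := total_γ_cycleVec_add_le d a l h (insert j (insert k S)) i (by simp [hi])
      have h₂ := total_γ_cycleVec_add_le d a l h (insert j (insert k S)) q
        (by rcases hq with rfl | rfl <;> simp)
      rw [hs] at h₁ h₂
      rcases le_total ((cycleVec d a l).2 i) ((cycleVec d a l).2 q) with h₃ | h₃ <;> linarith

theorem IsTourSum.isFeasible (C : Finpartition (Finset.univ : Finset T)) {z : Vec T D}
    (h : IsTourSum z) (hy : ∀ i, z.2 i = 0 ∨ z.2 i = 1) (hc : ∀ c ∈ C.parts, 1 ≤ ∑ i ∈ c, z.2 i) :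
    IsFeasible C z := by
  have hx : ∀ e, 0 ≤ z.1 e := fun e => by
    obtain ⟨n, hn⟩ := h.natural e
    simp [hn]
  have hy' : ∀ i, z.2 i ≤ 1 := fun i => by rcases hy i with h | h <;> simp [h]
  refine ⟨h.degree, hc, h.subtour, h.path₂, h.path, fun e he => ?_, fun e he => ?_, hy⟩
  · rcases edge_cases e with ⟨j, k, hjk, rfl⟩ | ⟨d, j, rfl⟩
    · obtain ⟨n, hn⟩ := h.natural (targetEdge j k hjk)
      -- The coefficient 3 matters here: `3 x_{jk} ≤ 2(y_j + y_k) ≤ 4` leaves only the values 0 and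
      -- 1.
      have h₁ := h.path₂ j k hjk ∅
      have h₂ := total_nonneg hx (between (depots ∅) (targets {j}))
      have h₃ := total_nonneg hx (between (targets {k}) (depots ∅ᶜ))
      have h₄ := hy' j
      have h₅ := hy' k
      have h₆ : (n : ℝ) < 2 := by linarith
      have h₇ : n < 2 := by exact_mod_cast h₆
      interval_cases n <;> simp [hn]
    · exact absurd he (depotEdge_notMem_γ d j _)
  · rcases edge_cases e with ⟨j, k, hjk, rfl⟩ | ⟨d, j, rfl⟩
    · exact absurd he (targetEdge_notMem_between hjk _ _)
    · obtain ⟨n, hn⟩ := h.natural (depotEdge d j)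
      have h₁ := le_total_of_mem hx ((depotEdge_mem_δ d j {j}).2 rfl)
      rw [h.degree] at h₁
      have h₄ := hy' j
      have h₆ : (n : ℝ) ≤ 2 := by linarith
      have h₇ : n ≤ 2 := by exact_mod_cast h₆
      interval_cases n <;> simp [hn]

end Feasible

/-! ### Generators of the direction space of the polytope -/

section Span

variable {T D : Type*} [Fintype T] [DecidableEq T] [Fintype D]

theorem cycleVec_singleton (d : D) (i : T) : cycleVec d i [] =
    targetVec i + edgeVec (Sum.inr d) (Sum.inl i) + edgeVec (Sum.inr d) (Sum.inl i) := rfl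

open Classical in
/-- The direction that increases `x_e` and decreases the edges from `d₀` to the ends of `e`, so that
all degrees of targets are unchanged. -/
noncomputable def shiftVec (d₀ : D) (e : Edge T D) : Vec T D :=
  (Pi.single e 1, 0) - ∑ i with Sum.inl i ∈ e.1, edgeVec (Sum.inr d₀) (Sum.inl i)

theorem shiftVec_targetEdge (d₀ : D) {j k : T} (h : j ≠ k) :
    shiftVec d₀ (targetEdge j k h) = edgeVec (Sum.inl j) (Sum.inl k)
      - edgeVec (Sum.inr d₀) (Sum.inl j) - edgeVec (Sum.inr d₀) (Sum.inl k) := by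
  classical
  have h₁ : ((Pi.single (targetEdge j k h) 1, 0) : Vec T D)
      = edgeVec (Sum.inl j) (Sum.inl k) := by
    refine Prod.ext (funext fun f => ?_) rfl
    simp [h, Pi.single_apply]
  have h₂ : (Finset.univ.filter fun i => Sum.inl i ∈ (targetEdge j k h : Edge T D).1) = {j, k} := by
    ext i; simp [targetEdge]
  rw [shiftVec, h₁]
  simp only [h₂]
  rw [Finset.sum_pair h]
  abel

theorem shiftVec_depotEdge (d₀ d : D) (j : T) :
    shiftVec d₀ (depotEdge d j)
      = edgeVec (Sum.inr d) (Sum.inl j) - edgeVec (Sum.inr d₀) (Sum.inl j) := by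
  classical
  have h₁ : ((Pi.single (depotEdge d j) 1, 0) : Vec T D)
      = edgeVec (Sum.inr d) (Sum.inl j) := by
    refine Prod.ext (funext fun f => ?_) rfl
    simp [Pi.single_apply]
  have h₂ : (Finset.univ.filter fun i => Sum.inl i ∈ (depotEdge d j : Edge T D).1) = {j} := by
    ext i; simp [depotEdge]
  rw [shiftVec, h₁]
  simp only [h₂]
  rw [Finset.sum_singleton]

@[simp] theorem shiftVec_snd (d₀ : D) (e : Edge T D) : (shiftVec d₀ e).2 = 0 := by
  simp [shiftVec, Prod.snd_sum]

open Classical in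
theorem shiftVec_fst_apply (d₀ : D) (e f : Edge T D) (hf : ∀ j, f ≠ depotEdge d₀ j) :
    (shiftVec d₀ e).1 f = if f = e then 1 else 0 := by
  simp [shiftVec, Prod.fst_sum, Finset.sum_apply, hf, Pi.single_apply]

theorem mem_δ_singleton (e : Edge T D) (i : T) : e ∈ δ (targets {i}) ↔ Sum.inl i ∈ e.1 := by
  rcases edge_cases e with ⟨j, k, h, rfl⟩ | ⟨d, j, rfl⟩
  · rw [targetEdge_mem_δ]
    simp only [Set.mem_singleton_iff, targetEdge, Sym2.mem_iff, Sum.inl.injEq]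
    grind
  · rw [depotEdge_mem_δ]
    simp [depotEdge, eq_comm]

theorem targetEdge_mem_δ_left {j k : T} (h : j ≠ k) :
    (targetEdge j k h : Edge T D) ∈ δ (targets {j}) := by
  simp [mem_δ_singleton, targetEdge]

theorem targetEdge_mem_δ_right {j k : T} (h : j ≠ k) :
    (targetEdge j k h : Edge T D) ∈ δ (targets {k}) := by
  simp [mem_δ_singleton, targetEdge]

theorem depotEdge_mem_δ_self (d : D) (j : T) : depotEdge d j ∈ δ (targets {j}) := by
  simp [mem_δ_singleton, depotEdge]

variable (C : Finpartition (Finset.univ : Finset T))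

theorem IsFeasible.snd_eq_one {C : Finpartition (Finset.univ : Finset T)} {z : Vec T D}
    (h : IsFeasible C z) {i : T} (hi : i ∈ W C) : z.2 i = 1 := by
  obtain ⟨a, ha⟩ := Finset.card_eq_one.1 (show (C.part i).card = 1 from hi)
  have hm : i ∈ C.part i := C.mem_part (Finset.mem_univ i)
  rw [ha, Finset.mem_singleton] at hm
  subst hm
  have := h.assignment _ (C.part_mem.2 (Finset.mem_univ i))
  rw [ha, Finset.sum_singleton] at this
  rcases h.int_y i with h₀ | h₀
  · linarith
  · exact h₀

/-- The linear map `(x, y) ↦ x_e`. -/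
def edgeMap (e : Edge T D) : Vec T D →ₗ[ℝ] ℝ := LinearMap.proj e ∘ₗ LinearMap.fst ℝ _ _

/-- The linear map `(x, y) ↦ y_i`. -/
def targetMap (i : T) : Vec T D →ₗ[ℝ] ℝ := LinearMap.proj i ∘ₗ LinearMap.snd ℝ _ _

/-- The linear map `(x, y) ↦ x(A)`. -/
noncomputable def totalMap (A : Set (Edge T D)) : Vec T D →ₗ[ℝ] ℝ where
  toFun z := total z.1 A
  map_add' _ _ := total_add _ _ _
  map_smul' _ _ := total_smul _ _ _

@[simp] theorem edgeMap_apply (e : Edge T D) (z : Vec T D) : edgeMap e z = z.1 e := rfl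

@[simp] theorem targetMap_apply (i : T) (z : Vec T D) : targetMap i z = z.2 i := rfl

@[simp] theorem totalMap_apply (A : Set (Edge T D)) (z : Vec T D) :
    totalMap A z = total z.1 A := rfl

/-- At each target `i` the shifts together remove `x(δ({i}))` from the edge between `d₀` and `i`,
and the cycles put `2 y_i` back; the degree equation cancels the two. The shift of an edge at `d₀`
itself is zero. -/
theorem eq_sum_shiftVec_add (d₀ : D) (z : Vec T D)
    (hz : ∀ i, total z.1 (δ (targets {i})) = 2 * z.2 i) :
    z = ∑ e, z.1 e • shiftVec d₀ e + ∑ i, z.2 i • cycleVec d₀ i [] := by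
  classical
  have h₁ : ∑ e, z.1 e • ((Pi.single e 1, 0) : Vec T D) = (z.1, 0) := by
    refine Prod.ext (funext fun f => ?_) (funext fun i => ?_)
    · simp [Prod.fst_sum, Finset.sum_apply, Pi.single_apply]
    · simp [Prod.snd_sum, Finset.sum_apply]
  have h₂ : ∑ i, z.2 i • targetVec i = ((0, z.2) : Vec T D) := by
    refine Prod.ext (funext fun f => ?_) (funext fun i => ?_)
    · simp [Prod.fst_sum, Finset.sum_apply]
    · simp [Prod.snd_sum, Finset.sum_apply]
  have h₃ : ∑ e, z.1 e • ∑ i with Sum.inl i ∈ e.1, edgeVec (Sum.inr d₀) (Sum.inl i)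
      = ∑ i, (2 * z.2 i) • (edgeVec (Sum.inr d₀) (Sum.inl i) : Vec T D) := by
    simp only [Finset.smul_sum, Finset.sum_filter]
    rw [Finset.sum_comm]
    refine Finset.sum_congr rfl fun i _ => ?_
    rw [← hz i, total, Finset.sum_smul, Finset.sum_filter]
    simp only [mem_δ_singleton, smul_ite, smul_zero]
  simp only [shiftVec, smul_sub, Finset.sum_sub_distrib, cycleVec_singleton, smul_add,
    Finset.sum_add_distrib]
  rw [h₁, h₂, h₃]
  simp only [two_mul, add_smul, Finset.sum_add_distrib]
  have : z = (z.1, (0 : T → ℝ)) + ((0 : Edge T D → ℝ), z.2) := by simp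
  nth_rewrite 1 [this]
  abel

/-- Reduces a bound on the whole direction space to membership of the generators; targets of `W`
need no cycle, since `y_i` is constant on feasible points. -/
theorem vectorSpan_feasible_le (d₀ : D) (Q : Submodule ℝ (Vec T D))
    (hs : ∀ e, shiftVec d₀ e ∈ Q) (hw : ∀ i ∉ W C, cycleVec d₀ i [] ∈ Q) :
    vectorSpan ℝ {z | IsFeasible C z} ≤ Q := by
  intro z hz
  rw [eq_sum_shiftVec_add d₀ z]
  · refine Q.add_mem (Q.sum_mem fun e _ => Q.smul_mem _ (hs e)) (Q.sum_mem fun i _ => ?_)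
    by_cases hi : i ∈ W C
    · have : z.2 i = 0 := linearMap_eq_zero_of_mem_vectorSpan (targetMap i) 1
        (fun z hz => IsFeasible.snd_eq_one hz hi) hz
      simp [this]
    · exact Q.smul_mem _ (hw i hi)
  · intro i
    have := linearMap_eq_zero_of_mem_vectorSpan
      (totalMap (δ (targets {i})) - (2 : ℝ) • targetMap i) 0
        (fun z (hz : IsFeasible C z) => by simp [hz.degree i]) hz
    simp at this
    linarith

/-- `z` is a sum of tours that visit each target of `A` once and no other target. -/
structure IsTourOn (z : Vec T D) (A : Finset T) : Prop where
  isTourSum : IsTourSum z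
  snd_eq : ∀ i, z.2 i = if i ∈ A then 1 else 0

theorem IsTourOn.zero : IsTourOn (0 : Vec T D) ∅ := ⟨.zero, by simp⟩

theorem IsTourOn.cycle (d : D) (a : T) (l : List T) (h : (a :: l).Nodup) :
    IsTourOn (cycleVec d a l) (a :: l).toFinset :=
  ⟨isTourSum_cycleVec d a l h, fun i => by rw [cycleVec_snd d a l h]; simp only [List.mem_toFinset]⟩

theorem IsTourOn.singleton (d : D) (i : T) : IsTourOn (cycleVec d i []) {i} := by
  simpa using IsTourOn.cycle d i [] (by simp)

theorem IsTourOn.add {z z' : Vec T D} {A B : Finset T} (h : IsTourOn z A) (h' : IsTourOn z' B)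
    (hAB : Disjoint A B) : IsTourOn (z + z') (A ∪ B) := by
  refine ⟨h.1.add h'.1, fun i => ?_⟩
  rw [Prod.snd_add, Pi.add_apply, h.2, h'.2]
  by_cases hi : i ∈ A
  · simp [hi, Finset.disjoint_left.1 hAB hi]
  · simp [hi]

/-- The solution obtained from `z` by adding a tour from `d₀` to each target outside `A`. -/
noncomputable def complete (d₀ : D) (z : Vec T D) (A : Finset T) : Vec T D :=
  z + ∑ i ∈ Aᶜ, cycleVec d₀ i []

theorem complete_fst_apply (d₀ : D) (z : Vec T D) (A : Finset T) (e : Edge T D)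
    (he : ∀ i ∉ A, e ≠ depotEdge d₀ i) : (complete d₀ z A).1 e = z.1 e := by
  simp only [complete, Prod.fst_add, Pi.add_apply, Prod.fst_sum, Finset.sum_apply]
  rw [Finset.sum_eq_zero, add_zero]
  intro i hi
  simp [cycleVec_singleton, he i (by simpa using hi)]

theorem complete_snd_apply (d₀ : D) (z : Vec T D) (A : Finset T) (i : T) :
    (complete d₀ z A).2 i = z.2 i + if i ∈ A then 0 else 1 := by
  simp only [complete, Prod.snd_add, Pi.add_apply, Prod.snd_sum, Finset.sum_apply]
  simp only [cycleVec_singleton, Prod.snd_add, Pi.add_apply, edgeVec_snd, Pi.zero_apply, add_zero,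
    targetVec_snd, Finset.sum_ite_eq, Finset.mem_compl, ite_not]

theorem isTourSum_complete (d₀ : D) {z : Vec T D} (h : IsTourSum z) (A : Finset T) :
    IsTourSum (complete d₀ z A) :=
  h.add (IsTourSum.sum _ _ fun i _ => isTourSum_cycleVec d₀ i [] (by simp))

theorem IsTourOn.complete_snd {d₀ : D} {z : Vec T D} {A : Finset T} (h : IsTourOn z A) (i : T) :
    (complete d₀ z A).2 i = 1 := by
  rw [complete_snd_apply, h.2]; split_ifs <;> simp

theorem IsTourOn.isFeasible_complete {d₀ : D} {z : Vec T D} {A : Finset T} (h : IsTourOn z A) :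
    IsFeasible C (complete d₀ z A) := by
  refine (isTourSum_complete d₀ h.1 A).isFeasible C (fun i => Or.inr (h.complete_snd i)) fun c hc => ?_
  simp only [h.complete_snd, Finset.sum_const, nsmul_eq_mul, mul_one]
  exact_mod_cast (C.nonempty_of_mem_parts hc).card_pos

theorem IsTourOn.complete_insert_snd {d₀ : D} {z : Vec T D} {A : Finset T} (h : IsTourOn z A)
    {i : T} (hi : i ∉ A) (k : T) :
    (complete d₀ z (insert i A)).2 k = if k = i then 0 else 1 := by
  rw [complete_snd_apply, h.2]
  by_cases hk : k = i
  · subst hk; simp [hi]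
  · by_cases hkA : k ∈ A <;> simp [hk, hkA]

/-- Leaving out `i` alone is allowed because its cluster contains another target, which is visited.
-/
theorem IsTourOn.isFeasible_complete_insert {d₀ : D} {z : Vec T D} {A : Finset T}
    (h : IsTourOn z A) {i : T} (hi : i ∉ A) (hW : i ∉ W C) :
    IsFeasible C (complete d₀ z (insert i A)) := by
  refine (isTourSum_complete d₀ h.1 _).isFeasible C (fun k => ?_) fun c hc => ?_
  · rw [h.complete_insert_snd hi]; split_ifs <;> simp
  · have : ∃ k ∈ c, k ≠ i := by
      by_contra! hcon
      obtain ⟨k, hk⟩ := C.nonempty_of_mem_parts hc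
      obtain rfl := hcon k hk
      apply hW
      change (C.part k).card = 1
      rw [C.part_eq_of_mem hc hk, Finset.card_eq_one]
      exact ⟨k, Finset.eq_singleton_iff_unique_mem.2 ⟨hk, hcon⟩⟩
    obtain ⟨k, hk, hki⟩ := this
    have h₁ : (complete d₀ z (insert i A)).2 k = 1 := by rw [h.complete_insert_snd hi, if_neg hki]
    rw [← h₁]
    refine Finset.single_le_sum (f := (complete d₀ z (insert i A)).2) (fun m _ => ?_) hk
    rw [h.complete_insert_snd hi]
    split_ifs <;> norm_num

/-- The added cycles are the same in both completions and cancel, so directions can be read off from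
the partial tours. -/
theorem sub_mem_vectorSpan_of_complete {F : Set (Vec T D)} {d₀ : D} {z z' : Vec T D} {A : Finset T}
    (hz : complete d₀ z A ∈ F) (hz' : complete d₀ z' A ∈ F) : z - z' ∈ vectorSpan ℝ F := by
  have := vsub_mem_vectorSpan ℝ hz hz'
  simpa [complete] using this

/-- For an edge between targets, merge two single-target cycles at `d₀` into one; for a depot edge,
move a single-target cycle to another depot and halve. The tours visit every target and use only `e`
and edges at `d₀`, so the lemma serves many faces `F` besides the full set. -/
theorem shiftVec_mem_vectorSpan {F : Set (Vec T D)} (d₀ : D) (e : Edge T D)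
    (hF : ∀ z, IsFeasible C z → (∀ i, z.2 i = 1) →
      (∀ f, f ≠ e → (∀ j, f ≠ depotEdge d₀ j) → z.1 f = 0) → z ∈ F) :
    shiftVec d₀ e ∈ vectorSpan ℝ F := by
  rcases edge_cases e with ⟨j, k, h, rfl⟩ | ⟨d, j, rfl⟩
  · have h₁ := IsTourOn.cycle d₀ j [k] (by simp [h])
    have h₂ := (IsTourOn.cycle d₀ j [] (by simp)).add (IsTourOn.cycle d₀ k [] (by simp))
      (by simpa using h)
    have hA : [j].toFinset ∪ [k].toFinset = [j, k].toFinset := by ext; simp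
    rw [hA] at h₂
    have := sub_mem_vectorSpan_of_complete (d₀ := d₀)
      (hF _ (h₁.isFeasible_complete C) (fun _ => h₁.complete_snd _) fun f hf hf' => by
        rw [complete_fst_apply _ _ _ _ fun i _ => hf' i]
        simp [cycleVec, pathVec, pathEnd, h, hf, hf'])
      (hF _ (h₂.isFeasible_complete C) (fun _ => h₂.complete_snd _) fun f hf hf' => by
        rw [complete_fst_apply _ _ _ _ fun i _ => hf' i]
        simp [cycleVec_singleton, hf'])
    convert this using 1
    simp only [shiftVec_targetEdge, cycleVec, pathVec, pathEnd]
    module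
  · have h₁ := IsTourOn.cycle d j [] (by simp)
    have h₂ := IsTourOn.cycle d₀ j [] (by simp)
    have := sub_mem_vectorSpan_of_complete (d₀ := d₀)
      (hF _ (h₁.isFeasible_complete C) (fun _ => h₁.complete_snd _) fun f hf hf' => by
        rw [complete_fst_apply _ _ _ _ fun i _ => hf' i]
        simp [cycleVec_singleton, hf])
      (hF _ (h₂.isFeasible_complete C) (fun _ => h₂.complete_snd _) fun f hf hf' => by
        rw [complete_fst_apply _ _ _ _ fun i _ => hf' i]
        simp [cycleVec_singleton, hf'])
    convert Submodule.smul_mem _ (1 / 2 : ℝ) this using 1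
    simp only [shiftVec_depotEdge, cycleVec_singleton]
    module

/-- Compare serving every target separately from `d₀` with doing so for all targets but `i`. -/
theorem cycleVec_mem_vectorSpan {F : Set (Vec T D)} (d₀ : D) {i : T} (hi : i ∉ W C)
    (hF : ∀ z, IsFeasible C z → (∀ k, k ≠ i → z.2 k = 1) →
      (∀ f, (∀ j, f ≠ depotEdge d₀ j) → z.1 f = 0) → z ∈ F) :
    cycleVec d₀ i [] ∈ vectorSpan ℝ F := by
  have h₁ := IsTourOn.cycle d₀ i [] (by simp)
  have h₂ := IsTourOn.zero (T := T) (D := D)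
  have := sub_mem_vectorSpan_of_complete (d₀ := d₀) (A := {i}) (z' := 0)
    (hF _ (h₁.isFeasible_complete C) (fun _ _ => h₁.complete_snd _) fun f hf' => by
      rw [complete_fst_apply _ _ _ _ fun i _ => hf' i]
      simp [cycleVec_singleton, hf'])
    (hF _ (h₂.isFeasible_complete_insert C (i := i) (by simp) hi)
      (fun k hk => by
        rw [← insert_empty_eq i, h₂.complete_insert_snd (by simp), if_neg hk]) fun f hf' => by
      rw [complete_fst_apply _ _ _ _ fun i _ => hf' i]
      simp)
  simpa using this

theorem shiftVec_mem (d₀ : D) (e : Edge T D) :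
    shiftVec d₀ e ∈ vectorSpan ℝ {z | IsFeasible C z} :=
  shiftVec_mem_vectorSpan C d₀ e fun _ hz _ _ => hz

theorem cycleVec_mem (d₀ : D) {i : T} (hi : i ∉ W C) :
    cycleVec d₀ i [] ∈ vectorSpan ℝ {z | IsFeasible C z} :=
  cycleVec_mem_vectorSpan C d₀ hi fun _ hz _ _ => hz

theorem exists_isFeasible_eq_zero (d₀ : D) : ∃ z : Vec T D, IsFeasible C z ∧ (∀ i, z.2 i = 1) ∧
    ∀ f, (∀ j, f ≠ depotEdge d₀ j) → z.1 f = 0 := by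
  have h₂ := IsTourOn.zero (T := T) (D := D)
  refine ⟨complete d₀ 0 ∅, h₂.isFeasible_complete C, fun _ => h₂.complete_snd _, fun f hf => ?_⟩
  rw [complete_fst_apply _ _ _ _ fun i _ => hf i]
  simp

theorem exists_isFeasible_depotEdge (d : D) (j : T) : ∃ z : Vec T D, IsFeasible C z ∧
    z.1 (depotEdge d j) = 2 := by
  have h₁ := IsTourOn.cycle d j [] (by simp)
  refine ⟨_, h₁.isFeasible_complete C (d₀ := d), ?_⟩
  rw [complete_fst_apply _ _ _ _ fun i hi => by simpa [eq_comm] using hi]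
  simp [cycleVec_singleton]; norm_num

theorem exists_isFeasible_targetEdge (d₀ : D) {j k : T} (h : j ≠ k) :
    ∃ z : Vec T D, IsFeasible C z ∧ z.1 (targetEdge j k h) = 1 := by
  have h₁ := IsTourOn.cycle d₀ j [k] (by simp [h])
  refine ⟨_, h₁.isFeasible_complete C (d₀ := d₀), ?_⟩
  rw [complete_fst_apply _ _ _ _ fun i hi => by simp]
  simp [cycleVec, pathVec, pathEnd, h]

end Span

/-! ### Bounds on feasible points, and the facets `y_i ≤ 1` and `x_e ≥ 0` -/

section Facets

variable {T D : Type*} [Fintype T] [DecidableEq T] [Fintype D]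

namespace IsFeasible

variable {C : Finpartition (Finset.univ : Finset T)} {z : Vec T D}

theorem fst_nonneg (h : IsFeasible C z) (e : Edge T D) : 0 ≤ z.1 e := by
  rcases edge_cases e with ⟨j, k, hjk, rfl⟩ | ⟨d, j, rfl⟩
  · rcases h.int_target _ ((targetEdge_mem_γ hjk _).2 (by simp)) with h | h <;> simp [h]
  · rcases h.int_depot _ ((depotEdge_mem_between d j _ _).2 (by simp)) with h | h | h <;> simp [h]

theorem fst_targetEdge_le_one (h : IsFeasible C z) {j k : T} (hjk : j ≠ k) :
    z.1 (targetEdge j k hjk) ≤ 1 := by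
  rcases h.int_target _ ((targetEdge_mem_γ hjk _).2 (by simp)) with h | h <;> simp [h]

theorem snd_nonneg (h : IsFeasible C z) (i : T) : 0 ≤ z.2 i := by
  rcases h.int_y i with h | h <;> simp [h]

theorem snd_le_one (h : IsFeasible C z) (i : T) : z.2 i ≤ 1 := by
  rcases h.int_y i with h | h <;> simp [h]

theorem fst_le (h : IsFeasible C z) {i : T} {e : Edge T D} (he : e ∈ δ (targets {i})) :
    z.1 e ≤ 2 * z.2 i :=
  h.degree i ▸ le_total_of_mem h.fst_nonneg he

theorem fst_add_le (h : IsFeasible C z) {i : T} {e f : Edge T D} (he : e ∈ δ (targets {i}))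
    (hf : f ∈ δ (targets {i})) (hef : e ≠ f) : z.1 e + z.1 f ≤ 2 * z.2 i := by
  classical
  rw [← h.degree i, total, ← Finset.sum_pair hef]
  refine Finset.sum_le_sum_of_subset_of_nonneg (fun g hg => ?_) fun g _ _ => h.fst_nonneg g
  rcases Finset.mem_insert.1 hg with rfl | hg
  · simpa using he
  · rw [Finset.mem_singleton.1 hg]; simpa using hf

theorem snd_eq_one_of_fst_eq_one (h : IsFeasible C z) {i : T} {e : Edge T D}
    (he : e ∈ δ (targets {i})) (h₁ : z.1 e = 1) : z.2 i = 1 := by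
  have := h.fst_le he
  rcases h.int_y i with h₀ | h₀
  · linarith
  · exact h₀

end IsFeasible

variable (C : Finpartition (Finset.univ : Finset T))

/-- Only the generator that drops `i` leaves the face. -/
theorem definesFacet_snd_le_one [Nonempty D] {i : T} (hi : i ∉ W C) :
    DefinesFacet (polytope (D := D) C) (fun z => z.2 i) (fun _ => 1) := by
  obtain ⟨d₀⟩ := ‹Nonempty D›
  obtain ⟨z₁, h₁, h₁', -⟩ := exists_isFeasible_eq_zero C d₀
  have h₂ := IsTourOn.zero (T := T) (D := D)
  refine definesFacet_of_span _ _ _ (targetMap i) 1 (fun z => by simp) (fun z hz => hz.snd_le_one i)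
    h₁ (h₁' i) (h₂.isFeasible_complete_insert C (d₀ := d₀) (i := i) (by simp) hi)
    (by rw [targetMap_apply, h₂.complete_insert_snd (by simp)]; simp) (cycleVec d₀ i [])
    (vectorSpan_feasible_le C d₀ _ (fun e => ?_) fun k hk => ?_)
  · exact Submodule.mem_sup_left (shiftVec_mem_vectorSpan C d₀ e fun z hz hz' _ => ⟨hz, hz' i⟩)
  · by_cases hki : k = i
    · subst hki
      exact Submodule.mem_sup_right (Submodule.mem_span_singleton_self _)
    · exact Submodule.mem_sup_left (cycleVec_mem_vectorSpan C d₀ hk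
        fun z hz hz' _ => ⟨hz, hz' i (Ne.symm hki)⟩)

theorem exists_isFeasible_ne_zero [Nonempty D] (e : Edge T D) :
    ∃ z : Vec T D, IsFeasible C z ∧ z.1 e ≠ 0 := by
  obtain ⟨d₀⟩ := ‹Nonempty D›
  rcases edge_cases e with ⟨j, k, hjk, rfl⟩ | ⟨d, j, rfl⟩
  · obtain ⟨z, hz, h⟩ := exists_isFeasible_targetEdge C d₀ hjk
    exact ⟨z, hz, by rw [h]; norm_num⟩
  · obtain ⟨z, hz, h⟩ := exists_isFeasible_depotEdge C d j
    exact ⟨z, hz, by rw [h]; norm_num⟩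

/-- The nonnegativity facets of the edges that avoid some depot `d₀`. -/
theorem definesFacet_zero_le_fst (d₀ : D) (e : Edge T D) (he : ∀ j, e ≠ depotEdge d₀ j) :
    DefinesFacet (polytope C) (fun _ => 0) (fun z => z.1 e) := by
  have : Nonempty D := ⟨d₀⟩
  obtain ⟨z₁, h₁, -, h₁'⟩ := exists_isFeasible_eq_zero C d₀
  obtain ⟨z₂, h₂, h₂'⟩ := exists_isFeasible_ne_zero C e
  refine definesFacet_of_span _ _ _ (-edgeMap e) 0 (fun z => by simp)
    (fun z hz => by simpa using hz.fst_nonneg e) h₁ (by simp [h₁' e he]) h₂ (by simpa using h₂')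
    (shiftVec d₀ e) (vectorSpan_feasible_le C d₀ _ (fun f => ?_) fun k hk => ?_)
  · by_cases hf : f = e
    · subst hf
      exact Submodule.mem_sup_right (Submodule.mem_span_singleton_self _)
    · exact Submodule.mem_sup_left (shiftVec_mem_vectorSpan C d₀ f
        fun z hz _ hz' => ⟨hz, by simp [hz' e (Ne.symm hf) he]⟩)
  · exact Submodule.mem_sup_left (cycleVec_mem_vectorSpan C d₀ hk
      fun z hz _ hz' => ⟨hz, by simp [hz' e he]⟩)

theorem exists_notMem_of_card_lt {s : Finset T} (h : s.card < Fintype.card T) : ∃ x, x ∉ s := by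
  obtain ⟨x, -, hx⟩ := Finset.exists_mem_notMem_of_card_lt_card (t := Finset.univ) h
  exact ⟨x, hx⟩

/-- The nonnegativity facets of the depot edges when there is only one depot. -/
theorem definesFacet_zero_le_fst_of_subsingleton [Subsingleton D] (hT : 4 ≤ Fintype.card T)
    (d : D) (j : T) :
    DefinesFacet (polytope C) (fun _ => 0) (fun z => z.1 (depotEdge d j)) := by
  -- The only use of `|T| ≥ 4`: three targets never exhaust `T`.
  have ex : ∀ a b c : T, ∃ x, x ≠ a ∧ x ≠ b ∧ x ≠ c := fun a b c => by
    obtain ⟨x, hx⟩ := exists_notMem_of_card_lt (T := T)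
      (lt_of_le_of_lt (Finset.card_le_three (a := a) (b := b) (c := c)) (by omega))
    exact ⟨x, by simpa using hx⟩
  set F : Set (Vec T D) := {z ∈ {z | IsFeasible C z} | (-edgeMap (depotEdge d j)) z = 0}
  have mem : ∀ (z : Vec T D) (A : Finset T), j ∈ A → IsFeasible C (complete d z A) →
      z.1 (depotEdge d j) = 0 → complete d z A ∈ F := by
    refine fun z A hj hz h₀ => ⟨hz, ?_⟩
    have : (complete d z A).1 (depotEdge d j) = z.1 (depotEdge d j) :=
      complete_fst_apply _ _ _ _ fun i hi => by
        rw [Ne, depotEdge_inj]; rintro ⟨-, rfl⟩; exact hi hj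
    simp [this, h₀]
  -- On this face `j`, if visited, must be an inner vertex of its path, hence tours `k, j, l` from
  -- `d`.
  have inner : ∀ k l, k ≠ j → l ≠ j → k ≠ l →
      IsTourOn (cycleVec d k [j, l]) {k, j, l} ∧ (cycleVec d k [j, l]).1 (depotEdge d j) = 0 := by
    refine fun k l hk hl hkl => ⟨?_, ?_⟩
    · simpa using IsTourOn.cycle d k [j, l] (by simp [hk, hl.symm, hkl])
    · simp [cycleVec, pathVec, pathEnd, hk, hl.symm, hk.symm]
  have single : ∀ i : T, IsTourOn (cycleVec d i []) {i} := IsTourOn.singleton d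
  have single' : ∀ i, i ≠ j → (cycleVec d i []).1 (depotEdge d j) = 0 := fun i hi => by
    simp [cycleVec_singleton, hi.symm]
  obtain ⟨k₀, hk₀, -, -⟩ := ex j j j
  obtain ⟨l₀, hl₀, hl₀', -⟩ := ex j k₀ k₀
  -- differences of directions at `j`
  have hdiff : ∀ k m (hk : k ≠ j) (hm : m ≠ j),
      shiftVec d (targetEdge k j hk) - shiftVec d (targetEdge m j hm) ∈ vectorSpan ℝ F := by
    intro k m hk hm
    by_cases hkm : k = m
    · subst hkm; simp
    obtain ⟨l, hl, hlk, hlm⟩ := ex j k m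
    obtain ⟨h₁, h₁'⟩ := inner k l hk hl hlk.symm
    obtain ⟨h₂, h₂'⟩ := inner m l hm hl hlm.symm
    have hA := h₁.add (single m) (by simp [hm, hlm.symm, Ne.symm hkm])
    have hB := h₂.add (single k) (by simp [hk, hlk.symm, hkm])
    rw [show ({m, j, l} ∪ {k} : Finset T) = {k, j, l} ∪ {m} by ext; simp; tauto] at hB
    have := sub_mem_vectorSpan_of_complete
      (mem _ _ (by simp) (hA.isFeasible_complete C) (by simp [h₁', single' m hm]))
      (mem _ _ (by simp) (hB.isFeasible_complete C) (by simp [h₂', single' k hk]))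
    convert this using 1
    simp only [shiftVec_targetEdge, cycleVec, pathVec, pathEnd]
    module
  -- Prepend `l` to the path `k, j, m`, instead of serving it alone.
  have hpair : ∀ k l (hkl : k ≠ l), k ≠ j → l ≠ j →
      shiftVec d (targetEdge k l hkl) ∈ vectorSpan ℝ F := by
    intro k l hkl hk hl
    obtain ⟨m, hm, hmk, hml⟩ := ex j k l
    have h₁ := IsTourOn.cycle d l [k, j, m]
      (by simp [hk, hl, hkl.symm, hml.symm, hmk.symm, hm.symm])
    have h₁' : (cycleVec d l [k, j, m]).1 (depotEdge d j) = 0 := by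
      simp [cycleVec, pathVec, pathEnd, hk, hl.symm, hkl.symm, hm.symm]
    obtain ⟨h₂, h₂'⟩ := inner k m hk hm hmk.symm
    have hB := h₂.add (single l) (by simp [hl, hkl.symm, hml.symm])
    rw [show [l, k, j, m].toFinset = ({k, j, m} ∪ {l} : Finset T) by ext; simp; tauto] at h₁
    have := sub_mem_vectorSpan_of_complete
      (mem _ _ (by simp) (h₁.isFeasible_complete C) h₁')
      (mem _ _ (by simp) (hB.isFeasible_complete C) (by simp [h₂', single' l hl]))
    convert this using 1
    simp only [shiftVec_targetEdge, cycleVec, pathVec, pathEnd,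
      edgeVec_comm (Sum.inl l) (Sum.inl k)]
    module
  have hdrop : ∀ i, i ≠ j → i ∉ W C → cycleVec d i [] ∈ vectorSpan ℝ F := by
    intro i hi hW
    obtain ⟨k, hk, hki, -⟩ := ex j i i
    obtain ⟨l, hl, hli, hlk⟩ := ex j i k
    obtain ⟨h₁, h₁'⟩ := inner k l hk hl hlk.symm
    have hi' : i ∉ ({k, j, l} : Finset T) := by simp [hi, hki.symm, hli.symm]
    have hA := h₁.add (single i) (by simpa using hi')
    have hins : ({k, j, l} ∪ {i} : Finset T) = insert i {k, j, l} := by ext; simp; tauto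
    rw [hins] at hA
    have := sub_mem_vectorSpan_of_complete
      (mem _ _ (by simp) (hA.isFeasible_complete C) (by simp [h₁', single' i hi]))
      (mem _ _ (by simp) (h₁.isFeasible_complete_insert C hi' hW) h₁')
    simpa using this
  -- Dropping `j` from the tour `k₀, j, l₀` also splits it, so the generator at `j` appears together
  -- with two shifts at `j`, which keep `x_{dj}` at zero.
  have hdropj : j ∉ W C → cycleVec d j [] + shiftVec d (targetEdge k₀ j hk₀)
      + shiftVec d (targetEdge l₀ j hl₀) ∈ vectorSpan ℝ F := by
    intro hW
    obtain ⟨h₁, h₁'⟩ := inner k₀ l₀ hk₀ hl₀ hl₀'.symm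
    have hB := (single k₀).add (single l₀) (by simpa using hl₀'.symm)
    have hj : j ∉ ({k₀} ∪ {l₀} : Finset T) := by simp [hk₀.symm, hl₀.symm]
    rw [show ({k₀, j, l₀} : Finset T) = insert j ({k₀} ∪ {l₀}) by ext; simp; tauto] at h₁
    have := sub_mem_vectorSpan_of_complete
      (mem _ _ (by simp) (h₁.isFeasible_complete C) h₁')
      (mem _ _ (by simp) (hB.isFeasible_complete_insert C hj hW)
        (by simp [single' k₀ hk₀, single' l₀ hl₀]))
    convert this using 1
    simp only [shiftVec_targetEdge, cycleVec, pathVec, pathEnd,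
      edgeVec_comm (Sum.inl l₀) (Sum.inl j)]
    module
  have : Nonempty D := ⟨d⟩
  obtain ⟨h₁, h₁'⟩ := inner k₀ l₀ hk₀ hl₀ hl₀'.symm
  obtain ⟨z₂, h₂, h₂'⟩ := exists_isFeasible_ne_zero C (depotEdge d j)
  obtain ⟨h₃, h₃'⟩ := mem _ _ (by simp) (h₁.isFeasible_complete C) h₁'
  have hQ : ∀ k (hk : k ≠ j), shiftVec d (targetEdge k j hk) ∈
      vectorSpan ℝ F ⊔ Submodule.span ℝ {shiftVec d (targetEdge k₀ j hk₀)} := by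
    intro k hk
    have := Submodule.add_mem _ (Submodule.mem_sup_left (hdiff k k₀ hk hk₀))
      (Submodule.mem_sup_right (Submodule.mem_span_singleton_self
        (R := ℝ) (shiftVec d (targetEdge k₀ j hk₀))))
    simpa using this
  refine definesFacet_of_span _ _ _ (-edgeMap (depotEdge d j)) 0 (fun z => by simp)
    (fun z hz => by simpa using hz.fst_nonneg _) h₃ h₃' h₂ (by simpa using h₂')
    (shiftVec d (targetEdge k₀ j hk₀)) (vectorSpan_feasible_le C d _ (fun f => ?_) fun i hi => ?_)
  · rcases edge_cases f with ⟨k, l, hkl, rfl⟩ | ⟨d', k, rfl⟩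
    · by_cases hk : k = j
      · subst hk
        rw [targetEdge_comm hkl]
        exact hQ l hkl.symm
      · by_cases hl : l = j
        · subst hl
          exact hQ k hkl
        · exact Submodule.mem_sup_left (hpair k l hkl hk hl)
    · rw [shiftVec_depotEdge, Subsingleton.elim d' d, sub_self]
      exact Submodule.zero_mem _
  · by_cases hij : i = j
    · subst hij
      have := Submodule.sub_mem _ (Submodule.sub_mem _ (Submodule.mem_sup_left (hdropj hi))
        (hQ l₀ hl₀)) (hQ k₀ hk₀)
      convert this using 1
      module
    · exact Submodule.mem_sup_left (hdrop i hij hi)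

end Facets

/-! ### The upper bounds on edges, and the inequalities that define no facet -/

section Facets

variable {T D : Type*} [Fintype T] [DecidableEq T] [Fintype D]
  (C : Finpartition (Finset.univ : Finset T))

theorem definesFacet_fst_le_one [Nonempty D] (hT : 3 ≤ Fintype.card T) {j k : T} (hjk : j ≠ k)
    (hj : j ∈ W C) (hk : k ∈ W C) :
    DefinesFacet (polytope (D := D) C) (fun z => z.1 (targetEdge j k hjk)) (fun _ => 1) := by
  obtain ⟨d₀⟩ := ‹Nonempty D›
  set F : Set (Vec T D) := {z ∈ {z | IsFeasible C z} | edgeMap (targetEdge j k hjk) z = 1}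
  have mem : ∀ (z : Vec T D) (A : Finset T), IsFeasible C (complete d₀ z A) →
      z.1 (targetEdge j k hjk) = 1 → complete d₀ z A ∈ F := by
    refine fun z A hz h₀ => ⟨hz, ?_⟩
    rw [edgeMap_apply, complete_fst_apply _ _ _ _ fun i hi => by simp, h₀]
  have single : ∀ (d : D) (i : T), IsTourOn (cycleVec d i []) {i} := IsTourOn.singleton
  have single' : ∀ (d : D) i, (cycleVec d i []).1 (targetEdge j k hjk) = 0 := fun d i => by
    simp [cycleVec_singleton]
  have pair : IsTourOn (cycleVec d₀ j [k]) {j, k} := by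
    simpa using IsTourOn.cycle d₀ j [k] (by simp [hjk])
  have pair' : (cycleVec d₀ j [k]).1 (targetEdge j k hjk) = 1 := by
    simp [cycleVec, pathVec, pathEnd, hjk]
  -- Prepend `l` to the path `a, b`, instead of serving it alone.
  have hside : ∀ a b l (hla : l ≠ a), l ≠ b → (a = j ∧ b = k ∨ a = k ∧ b = j) →
      shiftVec d₀ (targetEdge l a hla) ∈ vectorSpan ℝ F := by
    intro a b l hla hlb hab
    have hne : a ≠ b := by rcases hab with ⟨rfl, rfl⟩ | ⟨rfl, rfl⟩ <;> [exact hjk; exact hjk.symm]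
    have he : targetEdge j k hjk = (targetEdge a b hne : Edge T D) := by simp; tauto
    have h₁ := IsTourOn.cycle d₀ l [a, b] (by simp [hla, hlb, hne])
    have h₂ := (IsTourOn.cycle d₀ a [b] (by simp [hne])).add (single d₀ l) (by simp [hla, hlb])
    rw [show [l, a, b].toFinset = [a, b].toFinset ∪ {l} by ext; simp; tauto] at h₁
    have := sub_mem_vectorSpan_of_complete
      (mem _ _ (h₁.isFeasible_complete C)
        (by rw [he]; simp [cycleVec, pathVec, pathEnd, hla, hla.symm, hlb.symm, hne, hne.symm]))
      (mem _ _ (h₂.isFeasible_complete C)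
        (by rw [he]; simp [cycleVec, pathVec, pathEnd, hne]))
    convert this using 1
    simp only [shiftVec_targetEdge, cycleVec, pathVec, pathEnd]
    module
  have hpair : ∀ l m (hlm : l ≠ m), l ≠ j → l ≠ k → m ≠ j → m ≠ k →
      shiftVec d₀ (targetEdge l m hlm) ∈ vectorSpan ℝ F := by
    intro l m hlm hlj hlk hmj hmk
    have h₁ := pair.add (IsTourOn.cycle d₀ l [m] (by simp [hlm])) (by simp [*])
    have h₂ := pair.add ((single d₀ l).add (single d₀ m) (by simp [hlm])) (by simp [*])
    rw [show [l, m].toFinset = ({l} ∪ {m} : Finset T) by ext; simp] at h₁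
    have := sub_mem_vectorSpan_of_complete
      (mem _ _ (h₁.isFeasible_complete C) (by
        simp only [Prod.fst_add, Pi.add_apply, pair']
        simp [cycleVec, pathVec, pathEnd, hlm, hlj.symm, hmj.symm]))
      (mem _ _ (h₂.isFeasible_complete C) (by simp [pair', single']))
    convert this using 1
    simp only [shiftVec_targetEdge, cycleVec, pathVec, pathEnd]
    module
  have hdepot : ∀ d l, l ≠ j → l ≠ k → shiftVec d₀ (depotEdge d l) ∈ vectorSpan ℝ F := by
    intro d l hlj hlk
    have h₁ := pair.add (single d l) (by simp [*])
    have h₂ := pair.add (single d₀ l) (by simp [*])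
    have := sub_mem_vectorSpan_of_complete
      (mem _ _ (h₁.isFeasible_complete C) (by simp [pair', single']))
      (mem _ _ (h₂.isFeasible_complete C) (by simp [pair', single']))
    convert Submodule.smul_mem _ (1 / 2 : ℝ) this using 1
    simp only [shiftVec_depotEdge, cycleVec_singleton]
    module
  obtain ⟨l, hlj, hlk⟩ : ∃ l, l ≠ j ∧ l ≠ k := by
    obtain ⟨x, hx⟩ := exists_notMem_of_card_lt (T := T)
      (lt_of_le_of_lt (Finset.card_le_two (a := j) (b := k)) (by omega))
    exact ⟨x, by simpa using hx⟩
  -- Moving the tour `a, b, l` from `d₀` to `d` shifts the depot edges of both `a` and `l`; the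
  -- shift at `l` is already known. A third target is essential: with only `a` and `b`, the depot
  -- edges of both always move together.
  have hdepot' : ∀ (d : D) a b, (a = j ∧ b = k ∨ a = k ∧ b = j) →
      shiftVec d₀ (depotEdge d a) ∈ vectorSpan ℝ F := by
    intro d a b hab
    have hne : a ≠ b := by rcases hab with ⟨rfl, rfl⟩ | ⟨rfl, rfl⟩ <;> [exact hjk; exact hjk.symm]
    have hla : l ≠ a := by rcases hab with ⟨rfl, rfl⟩ | ⟨rfl, rfl⟩ <;> assumption
    have hlb : l ≠ b := by rcases hab with ⟨rfl, rfl⟩ | ⟨rfl, rfl⟩ <;> assumption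
    have he : targetEdge j k hjk = (targetEdge a b hne : Edge T D) := by simp; tauto
    have h₁ : ∀ d : D, IsTourOn (cycleVec d a [b, l]) [a, b, l].toFinset := fun d =>
      IsTourOn.cycle d a [b, l] (by simp [hla.symm, hlb.symm, hne])
    have h₂ : ∀ d : D, (cycleVec d a [b, l]).1 (targetEdge j k hjk) = 1 := fun d => by
      rw [he]; simp [cycleVec, pathVec, pathEnd, hla.symm, hlb.symm, hne]
    have := Submodule.sub_mem _ (sub_mem_vectorSpan_of_complete
      (mem _ _ ((h₁ d).isFeasible_complete C) (h₂ d))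
      (mem _ _ ((h₁ d₀).isFeasible_complete C) (h₂ d₀))) (hdepot d l hlj hlk)
    convert this using 1
    simp only [shiftVec_depotEdge, cycleVec, pathVec, pathEnd]
    module
  have hdrop : ∀ i ∉ W C, cycleVec d₀ i [] ∈ vectorSpan ℝ F := by
    intro i hW
    have hi' : i ∉ ({j, k} : Finset T) := by
      simp only [Finset.mem_insert, Finset.mem_singleton, not_or]
      exact ⟨fun h => hW (h ▸ hj), fun h => hW (h ▸ hk)⟩
    have hA := pair.add (single d₀ i) (by simpa using hi')
    have hins : ({j, k} ∪ {i} : Finset T) = insert i {j, k} := by ext; simp; tauto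
    rw [hins] at hA
    have := sub_mem_vectorSpan_of_complete
      (mem _ _ (hA.isFeasible_complete C) (by simp [pair', single']))
      (mem _ _ (pair.isFeasible_complete_insert C hi' hW) pair')
    simpa using this
  obtain ⟨h₁, h₁'⟩ := mem _ _ (pair.isFeasible_complete C) pair'
  obtain ⟨z₂, h₂, -, h₂'⟩ := exists_isFeasible_eq_zero C d₀
  refine definesFacet_of_span _ _ _ (edgeMap (targetEdge j k hjk)) 1 (fun z => by simp)
    (fun z hz => hz.fst_targetEdge_le_one hjk) h₁ h₁' h₂
    (by rw [edgeMap_apply, h₂' _ (by simp)]; norm_num)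
    (shiftVec d₀ (targetEdge j k hjk))
    (vectorSpan_feasible_le C d₀ _ (fun f => ?_) fun i hi => Submodule.mem_sup_left (hdrop i hi))
  rcases edge_cases f with ⟨l, m, hlm, rfl⟩ | ⟨d, l, rfl⟩
  · by_cases he : (targetEdge l m hlm : Edge T D) = targetEdge j k hjk
    · rw [he]
      exact Submodule.mem_sup_right (Submodule.mem_span_singleton_self _)
    refine Submodule.mem_sup_left ?_
    rw [targetEdge_inj] at he
    by_cases hmj : m = j
    · exact hside m k l hlm (by grind) (by grind)
    by_cases hmk : m = k
    · exact hside m j l hlm (by grind) (by grind)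
    by_cases hlj : l = j
    · rw [targetEdge_comm hlm]
      exact hside l k m hlm.symm (by grind) (by grind)
    by_cases hlk : l = k
    · rw [targetEdge_comm hlm]
      exact hside l j m hlm.symm (by grind) (by grind)
    exact hpair l m hlm hlj hlk hmj hmk
  · refine Submodule.mem_sup_left ?_
    by_cases hlj : l = j
    · exact hdepot' d l k (by grind)
    by_cases hlk : l = k
    · exact hdepot' d l j (by grind)
    exact hdepot d l hlj hlk

/-- Using the edge forces a visit to `j`, so `y_j = 1` is a second equation, and it is not constant
as `j ∉ W`. -/
theorem not_definesFacet_fst_le_one_of_notMem [Nonempty D] {j k : T} (hjk : j ≠ k)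
    (hj : j ∉ W C) :
    ¬ DefinesFacet (polytope (D := D) C) (fun z => z.1 (targetEdge j k hjk)) (fun _ => 1) := by
  obtain ⟨d₀⟩ := ‹Nonempty D›
  refine not_definesFacet_of_linearMap _ _ _ (edgeMap (targetEdge j k hjk)) 1 (fun z => by simp)
    (targetMap j) 1 (fun z hz h => hz.snd_eq_one_of_fst_eq_one (targetEdge_mem_δ_left hjk) h)
    (shiftVec_mem C d₀ (targetEdge j k hjk)) (cycleVec_mem C d₀ hj) ?_ (by simp)
    (by simp [cycleVec_singleton])
  rw [edgeMap_apply, shiftVec_fst_apply _ _ _ (by simp)]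
  simp

/-- A path with targets `j, k` may not join different depots. The constraint with `D' = {d}` gives
`x_{dj} + x({k} : D \ {d}) ≤ 1`, and the degree of `k` gives `1 ≤ x_{dk} + x({k} : D \ {d})`. -/
theorem IsFeasible.fst_depotEdge_le {C : Finpartition (Finset.univ : Finset T)} {z : Vec T D}
    (hz : IsFeasible C z) {j k : T} (hjk : j ≠ k) (hT : ∀ i, i = j ∨ i = k)
    (h : z.1 (targetEdge j k hjk) = 1) (d : D) :
    z.1 (depotEdge d j) ≤ z.1 (depotEdge d k) := by
  classical
  have hp := hz.path₂ j k hjk {d}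
  have hyj := hz.snd_le_one j
  have hyk := hz.snd_eq_one_of_fst_eq_one (targetEdge_mem_δ_right hjk) h
  have hd := hz.degree k
  have h₁ : z.1 (depotEdge d j) ≤ total z.1 (between (depots {d}) (targets {j})) :=
    le_total_of_mem hz.fst_nonneg ((depotEdge_mem_between _ _ _ _).2 (by simp))
  have h₂ : total z.1 (δ (targets {k})) ≤ z.1 (targetEdge j k hjk) + z.1 (depotEdge d k)
      + total z.1 (between (targets {k}) (depots {d}ᶜ)) := by
    have hsub : (Finset.univ.filter fun e => e ∈ δ (targets {k}))
        ⊆ insert (targetEdge j k hjk) (insert (depotEdge d k)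
          (Finset.univ.filter fun e => e ∈ between (targets {k}) (depots {d}ᶜ))) := by
      intro e he
      replace he := (Finset.mem_filter.1 he).2
      rcases edge_cases e with ⟨a, b, hab, rfl⟩ | ⟨d', a, rfl⟩
      · refine Finset.mem_insert.2 (Or.inl ?_)
        rw [targetEdge_inj]
        have := hT a
        have := hT b
        grind
      · rw [depotEdge_mem_δ, Set.mem_singleton_iff] at he
        subst he
        by_cases hd' : d' = d
        · simp [hd']
        · simp only [Finset.mem_insert, Finset.mem_filter, Finset.mem_univ, true_and]
          right; right
          rw [between_comm, depotEdge_mem_between]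
          simp [hd']
    refine (Finset.sum_le_sum_of_subset_of_nonneg hsub fun e _ _ => hz.fst_nonneg e).trans ?_
    rw [Finset.sum_insert, Finset.sum_insert, add_assoc, total]
    · rw [between_comm]
      simp [depotEdge_mem_between]
    · rw [between_comm]
      simp [targetEdge_notMem_between]
  linarith

/-- By symmetry `x_{dj} = x_{dk}` on the face, and a second depot makes this a genuine restriction.
-/
theorem not_definesFacet_fst_le_one_of_card_eq_two {j k : T} (hjk : j ≠ k)
    (hT : ∀ i, i = j ∨ i = k) {d d₀ : D} (hd : d ≠ d₀) :
    ¬ DefinesFacet (polytope (D := D) C) (fun z => z.1 (targetEdge j k hjk)) (fun _ => 1) := by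
  refine not_definesFacet_of_linearMap _ _ _ (edgeMap (targetEdge j k hjk)) 1 (fun z => by simp)
    (edgeMap (depotEdge d j) - edgeMap (depotEdge d k)) 0 (fun z hz h => ?_)
    (shiftVec_mem C d₀ (targetEdge j k hjk)) (shiftVec_mem C d₀ (depotEdge d j)) ?_ ?_ ?_
  · have h₁ := hz.fst_depotEdge_le hjk hT h d
    have h₂ := hz.fst_depotEdge_le hjk.symm (fun i => (hT i).symm)
      (by rw [← targetEdge_comm hjk]; exact h) d
    simp only [LinearMap.sub_apply, edgeMap_apply]
    linarith
  · rw [edgeMap_apply, shiftVec_fst_apply _ _ _ (by simp)]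
    simp
  · rw [LinearMap.sub_apply, edgeMap_apply, edgeMap_apply, shiftVec_fst_apply _ _ _ (by simp [hd]),
      shiftVec_fst_apply _ _ _ (by simp [hd])]
    simp
  · rw [LinearMap.sub_apply, edgeMap_apply, edgeMap_apply, shiftVec_fst_apply _ _ _ (by simp [hd]),
      shiftVec_fst_apply _ _ _ (by simp [hd])]
    simp [hjk.symm]

theorem not_definesFacet_fst_depotEdge_le_one (d : D) (j : T) :
    ¬ DefinesFacet (polytope C) (fun z => z.1 (depotEdge d j)) (fun _ => 1) := by
  rintro ⟨h, -⟩
  obtain ⟨z, hz, hz'⟩ := exists_isFeasible_depotEdge C d j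
  have : z.1 (depotEdge d j) ≤ 1 := h z (subset_convexHull _ _ hz)
  rw [hz'] at this
  norm_num at this

theorem definesFacet_fst_le_one_iff [Nonempty D]
    (h : ¬ (Fintype.card D = 1 ∧ Fintype.card T = 2)) (e : Edge T D) :
    DefinesFacet (polytope C) (fun z => z.1 e) (fun _ => 1) ↔
      e ∈ γ (targets (W C)) ∧ 3 ≤ Fintype.card T := by
  rcases edge_cases e with ⟨j, k, hjk, rfl⟩ | ⟨d, j, rfl⟩
  · rw [targetEdge_mem_γ]
    constructor
    · intro hf
      have hj : j ∈ W C := by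
        by_contra hj
        exact not_definesFacet_fst_le_one_of_notMem C hjk hj hf
      have hk : k ∈ W C := by
        by_contra hk
        rw [targetEdge_comm] at hf
        exact not_definesFacet_fst_le_one_of_notMem C hjk.symm hk hf
      refine ⟨⟨hj, hk⟩, ?_⟩
      by_contra! hT
      have hc : ({j, k} : Finset T).card = 2 := Finset.card_pair hjk
      have hle := Finset.card_le_univ ({j, k} : Finset T)
      have hu : ({j, k} : Finset T) = Finset.univ :=
        Finset.eq_univ_of_card _ (by omega)
      have hT' : ∀ i, i = j ∨ i = k := fun i => by
        have hi := Finset.mem_univ i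
        rw [← hu] at hi
        simpa using hi
      have hD : 1 < Fintype.card D := by
        have := Fintype.card_pos (α := D)
        omega
      obtain ⟨d, d₀, hd⟩ := Fintype.exists_pair_of_one_lt_card hD
      exact not_definesFacet_fst_le_one_of_card_eq_two C hjk hT' hd hf
    · rintro ⟨⟨hj, hk⟩, hT⟩
      exact definesFacet_fst_le_one C hT hjk hj hk
  · exact iff_of_false (not_definesFacet_fst_depotEdge_le_one C d j)
      fun h => depotEdge_notMem_γ _ _ _ h.1

/-- The value 2 exhausts the degree of `j`, so every other edge `f` at `j` vanishes on the face. -/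
theorem not_definesFacet_fst_le_two (d : D) (j : T) {d₀ : D} {f : Edge T D} {v : Vec T D}
    (hf : f ∈ δ (targets {j})) (hfd : depotEdge d j ≠ f) (hf₀ : ∀ i, f ≠ depotEdge d₀ i)
    (hv : v ∈ vectorSpan ℝ {z | IsFeasible C z}) (h₁ : v.1 (depotEdge d j) ≠ 0)
    (h₂ : v.1 f = 0) :
    ¬ DefinesFacet (polytope C) (fun z => z.1 (depotEdge d j)) (fun _ => 2) := by
  refine not_definesFacet_of_linearMap _ _ _ (edgeMap (depotEdge d j)) 2 (fun z => by simp)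
    (edgeMap f) 0 (fun z hz h => ?_) hv (shiftVec_mem C d₀ f) h₁ h₂ ?_
  · have := hz.fst_add_le (depotEdge_mem_δ_self d j) hf hfd
    have := hz.snd_le_one j
    have := hz.fst_nonneg f
    simp only [edgeMap_apply] at h ⊢
    linarith
  · rw [edgeMap_apply, shiftVec_fst_apply _ _ _ hf₀]
    simp

theorem not_definesFacet_fst_depotEdge_le_two (h : Fintype.card D + Fintype.card T ≠ 3)
    (d : D) (j : T) :
    ¬ DefinesFacet (polytope C) (fun z => z.1 (depotEdge d j)) (fun _ => 2) := by
  classical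
  by_cases hD : ∃ d₀, d₀ ≠ d
  · obtain ⟨d₀, hd₀⟩ := hD
    obtain ⟨f, hf, hfd, hf₀⟩ : ∃ f : Edge T D, f ∈ δ (targets {j}) ∧ f ≠ depotEdge d j ∧
        ∀ i, f ≠ depotEdge d₀ i := by
      by_cases hT : ∃ k, k ≠ j
      · obtain ⟨k, hk⟩ := hT
        exact ⟨targetEdge k j hk, targetEdge_mem_δ_right hk, by simp, by simp⟩
      · push Not at hT
        have hT₁ : Fintype.card T = 1 := Fintype.card_eq_one_iff.2 ⟨j, hT⟩
        have hD₁ : 1 < Fintype.card D := Fintype.one_lt_card_iff.2 ⟨d₀, d, hd₀⟩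
        -- With one target and at least two depots, `|D| + |T| ≠ 3` provides a third depot.
        obtain ⟨d₁, hd₁⟩ : ∃ x, x ∉ ({d, d₀} : Finset D) := by
          exact exists_notMem_of_card_lt (by rw [Finset.card_pair hd₀.symm]; omega)
        simp only [Finset.mem_insert, Finset.mem_singleton, not_or] at hd₁
        exact ⟨depotEdge d₁ j, depotEdge_mem_δ_self _ _, by simp [hd₁.1], by simp [hd₁.2]⟩
    refine not_definesFacet_fst_le_two C d j hf hfd.symm hf₀
      (shiftVec_mem C d₀ (depotEdge d j)) ?_ ?_
    · rw [shiftVec_fst_apply _ _ _ (by simp [hd₀.symm])]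
      simp
    · rw [shiftVec_fst_apply _ _ _ hf₀]
      simp [hfd]
  · push Not at hD
    have hD₁ : Fintype.card D = 1 := Fintype.card_eq_one_iff.2 ⟨d, hD⟩
    by_cases hT : Fintype.card T = 1
    · obtain ⟨i, hi⟩ := Fintype.card_eq_one_iff.1 hT
      refine not_definesFacet_of_const _ _ _ (edgeMap (depotEdge d j)) 2 (fun z => by simp)
        fun z hz => ?_
      have hW : j ∈ W C := by
        change (C.part j).card = 1
        refine Finset.card_eq_one.2 ⟨j, Finset.eq_singleton_iff_unique_mem.2
          ⟨C.mem_part (Finset.mem_univ j), fun k _ => (hi k).trans (hi j).symm⟩⟩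
      have hdeg := hz.degree j
      have hfil : (Finset.univ.filter fun e : Edge T D => e ∈ δ (targets {j})) = {depotEdge d j} := by
        ext e
        rcases edge_cases e with ⟨a, b, hab, rfl⟩ | ⟨d', a, rfl⟩
        · exact absurd ((hi a).trans (hi b).symm) hab
        · simp [depotEdge_mem_δ, hD d']
      rw [total, hz.snd_eq_one hW, hfil, Finset.sum_singleton] at hdeg
      simpa using hdeg
    · have hT₀ : 0 < Fintype.card T := Fintype.card_pos_iff.2 ⟨j⟩
      obtain ⟨k, hk⟩ := exists_notMem_of_card_lt (T := T) (s := {j}) (by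
        rw [Finset.card_singleton]; omega)
      rw [Finset.mem_singleton] at hk
      -- With one depot and at least two targets, `|D| + |T| ≠ 3` provides a third target, whose
      -- edge to `j` changes `x_{dj}` but not `f`.
      obtain ⟨l, hl⟩ := exists_notMem_of_card_lt (T := T) (s := {j, k}) (by
        rw [Finset.card_pair (Ne.symm hk)]; omega)
      simp only [Finset.mem_insert, Finset.mem_singleton, not_or] at hl
      refine not_definesFacet_fst_le_two C d j (f := targetEdge k j hk) (d₀ := d)
        (targetEdge_mem_δ_right hk) (by simp) (by simp)
        (shiftVec_mem C d (targetEdge l j hl.1)) ?_ ?_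
      · rw [shiftVec_targetEdge]
        simp [hl.1, Ne.symm hl.1]
      · rw [shiftVec_fst_apply _ _ _ (by simp)]
        simp [hk, Ne.symm hl.2]

theorem exists_ne_of_notMem_W {i : T} (hi : i ∉ W C) : ∃ k ∈ C.part i, k ≠ i := by
  by_contra! hcon
  exact hi (Finset.card_eq_one.2 ⟨i, Finset.eq_singleton_iff_unique_mem.2
    ⟨C.mem_part (Finset.mem_univ i), hcon⟩⟩)

/-- For `i ∈ W` the face is empty. Otherwise `y_i = 0` kills the edges at `i`, in particular one to
another target of its cluster. -/
theorem not_definesFacet_zero_le_snd [Nonempty D] (i : T) :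
    ¬ DefinesFacet (polytope (D := D) C) (fun _ => 0) (fun z => z.2 i) := by
  obtain ⟨d₀⟩ := ‹Nonempty D›
  by_cases hi : i ∈ W C
  · intro hf
    obtain ⟨-, ⟨z, hz, hz'⟩, -⟩ := (definesFacet_convexHull_iff {z | IsFeasible C z} _ _
      (-targetMap i) 0 (fun z => by simp)).1 hf
    have := hz.snd_eq_one hi
    simp [this] at hz'
  · obtain ⟨k, -, hk⟩ := exists_ne_of_notMem_W C hi
    refine not_definesFacet_of_linearMap _ _ _ (-targetMap i) 0 (fun z => by simp)
      (edgeMap (targetEdge k i hk)) 0 (fun z hz h => ?_) (cycleVec_mem C d₀ hi)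
      (shiftVec_mem C d₀ (targetEdge k i hk)) (by simp [cycleVec_singleton])
      (by simp [cycleVec_singleton]) ?_
    · have h₁ := hz.fst_le (targetEdge_mem_δ_right hk)
      have h₂ := hz.fst_nonneg (targetEdge k i hk)
      simp only [LinearMap.neg_apply, targetMap_apply, edgeMap_apply] at h ⊢
      linarith
    · rw [edgeMap_apply, shiftVec_fst_apply _ _ _ (by simp)]
      simp

theorem definesFacet_snd_le_one_iff [Nonempty D] (i : T) :
    DefinesFacet (polytope (D := D) C) (fun z => z.2 i) (fun _ => 1) ↔ i ∉ W C :=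
  ⟨fun hf hi => not_definesFacet_of_const _ _ _ (targetMap i) 1 (fun z => by simp)
    (fun _ hz => IsFeasible.snd_eq_one hz hi) hf, definesFacet_snd_le_one C⟩

/-- For a singleton cluster equality always holds. Otherwise equality means a single visited target,
so edges inside the cluster vanish. -/
theorem not_definesFacet_one_le_sum [Nonempty D] {c : Finset T} (hc : c ∈ C.parts) :
    ¬ DefinesFacet (polytope (D := D) C) (fun _ => 1) (fun z => ∑ i ∈ c, z.2 i) := by
  obtain ⟨d₀⟩ := ‹Nonempty D›
  obtain ⟨j, hj⟩ := C.nonempty_of_mem_parts hc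
  have hcj : C.part j = c := C.part_eq_of_mem hc hj
  have hL : ∀ z : Vec T D, ∑ i ∈ c, z.2 i - 1
      = -1 - (-∑ i ∈ c, targetMap i : Vec T D →ₗ[ℝ] ℝ) z := fun z => by
    simp [LinearMap.sum_apply]
    ring
  by_cases hW : j ∈ W C
  · refine not_definesFacet_of_const _ _ _ _ (-1) hL fun z hz => ?_
    obtain ⟨a, ha⟩ := Finset.card_eq_one.1 (show (C.part j).card = 1 from hW)
    rw [hcj] at ha
    subst ha
    obtain rfl := Finset.mem_singleton.1 hj
    simp [hz.snd_eq_one hW]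
  · obtain ⟨k, hk, hkj⟩ := exists_ne_of_notMem_W C hW
    rw [hcj] at hk
    refine not_definesFacet_of_linearMap _ _ _ _ (-1) hL
      (edgeMap (targetEdge k j hkj)) 0 (fun z hz h => ?_) (cycleVec_mem C d₀ hW)
      (shiftVec_mem C d₀ (targetEdge k j hkj)) ?_ (by simp [cycleVec_singleton]) ?_
    · have h₁ : z.2 k + z.2 j ≤ ∑ i ∈ c, z.2 i := by
        rw [← Finset.sum_pair hkj]
        refine Finset.sum_le_sum_of_subset_of_nonneg (fun i hi => ?_) fun i _ _ => hz.snd_nonneg i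
        rcases Finset.mem_insert.1 hi with rfl | hi
        · exact hk
        · rwa [Finset.mem_singleton.1 hi]
      have h₂ : ∑ i ∈ c, z.2 i = 1 := by
        have := hL z
        rw [h] at this
        linarith
      rw [edgeMap_apply]
      rcases hz.int_target _ ((targetEdge_mem_γ hkj _).2 (by simp)) with h₀ | h₀
      · exact h₀
      · have := hz.snd_eq_one_of_fst_eq_one (targetEdge_mem_δ_left hkj) h₀
        have := hz.snd_eq_one_of_fst_eq_one (targetEdge_mem_δ_right hkj) h₀
        linarith
    · simp [cycleVec_singleton, LinearMap.sum_apply, hj]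
    · rw [edgeMap_apply, shiftVec_fst_apply _ _ _ (by simp)]
      simp

theorem definesFacet_zero_le_fst_of_four_le_card [Nonempty D] (hT : 4 ≤ Fintype.card T)
    (e : Edge T D) : DefinesFacet (polytope C) (fun _ => 0) (fun z => z.1 e) := by
  rcases edge_cases e with ⟨j, k, hjk, rfl⟩ | ⟨d, j, rfl⟩
  · exact definesFacet_zero_le_fst C (Classical.arbitrary D) _ (by simp)
  · rcases subsingleton_or_nontrivial D with _ | _
    · exact definesFacet_zero_le_fst_of_subsingleton C hT d j
    · obtain ⟨d₀, hd₀⟩ := exists_ne d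
      exact definesFacet_zero_le_fst C d₀ _ (by simp [hd₀.symm])

end Facets

end GMDTSP

theorem proposition3 {T D : Type*} [Fintype T] [DecidableEq T] [Fintype D] [Nonempty D]
    (C : Finpartition (Finset.univ : Finset T)) :
    -- (1) `x_e ≥ 0`
    (4 ≤ Fintype.card T → ∀ e : GMDTSP.Edge T D,
      GMDTSP.DefinesFacet (GMDTSP.polytope C) (fun _ => 0) (fun z => z.1 e)) ∧
    -- (2) `x_e ≤ 1`
    (¬ (Fintype.card D = 1 ∧ Fintype.card T = 2) → ∀ e : GMDTSP.Edge T D,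
      (GMDTSP.DefinesFacet (GMDTSP.polytope C) (fun z => z.1 e) (fun _ => 1) ↔
        e ∈ GMDTSP.γ (GMDTSP.targets (GMDTSP.W C)) ∧ 3 ≤ Fintype.card T)) ∧
    -- (3) `x_e ≤ 2`
    (Fintype.card D + Fintype.card T ≠ 3 →
      ∀ e ∈ GMDTSP.between (GMDTSP.depots (Set.univ : Set D)) (GMDTSP.targets (Set.univ : Set T)),
        ¬ GMDTSP.DefinesFacet (GMDTSP.polytope C) (fun z => z.1 e) (fun _ => 2)) ∧
    -- (4) `y_i ≥ 0`
    (∀ i : T, ¬ GMDTSP.DefinesFacet (GMDTSP.polytope (D := D) C) (fun _ => 0) (fun z => z.2 i)) ∧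
    -- (5) `y_i ≤ 1`
    (∀ i : T, GMDTSP.DefinesFacet (GMDTSP.polytope (D := D) C) (fun z => z.2 i) (fun _ => 1) ↔
      i ∉ GMDTSP.W C) ∧
    -- (6) `∑_{i ∈ C_h} y_i ≥ 1`
    (∀ c ∈ C.parts, ¬ GMDTSP.DefinesFacet (GMDTSP.polytope (D := D) C)
      (fun _ => 1) (fun z => ∑ i ∈ c, z.2 i)) := by
  refine ⟨fun hT e => GMDTSP.definesFacet_zero_le_fst_of_four_le_card C hT e,
    fun h e => GMDTSP.definesFacet_fst_le_one_iff C h e, fun h e he => ?_,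
    fun i => GMDTSP.not_definesFacet_zero_le_snd C i,
    fun i => GMDTSP.definesFacet_snd_le_one_iff C i,
    fun c hc => GMDTSP.not_definesFacet_one_le_sum C hc⟩
  rcases GMDTSP.edge_cases e with ⟨j, k, hjk, rfl⟩ | ⟨d, j, rfl⟩
  · exact absurd he (GMDTSP.targetEdge_notMem_between hjk _ _)
  · exact GMDTSP.not_definesFacet_fst_depotEdge_le_two C h d j
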